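/- Let $n,m\ge 0$ and $d_1,\dots,d_n\ge 0$ be integers, $d=d_1+\cdots+d_n$, and write $x=(x_1,\dots,x_n)\in\mathbb R^d$ with blocks $x_i\in\mathbb R^{d_i}$. Let $H\in\mathbb R^{d\times d}$ be symmetric positive semidefinite with blocks $H_{ij}\in\mathbb R^{d_i\times d_j}$, let $g\in\mathbb R^d$, $A_i\in\mathbb R^{m\times d_i}$, $A=(A_1,\dots,A_n)$, $b\in\mathbb R^m$ and $\beta>0$. Consider $$\min_{x\in\mathbb R^d}\ \tfrac12 x^\top Hx+g^\top x\quad\text{subject to}\quad \sum_{i=1}^n A_ix_i=b. \tag{1}$$ A KKT point of (1) is a pair $(\bar x,\bar\mu)\in\mathbb R^d\times\mathbb R^m$ with $-(H\bar x+g)_i+A_i^\top\bar\mu=0$ for $i=1,\dots,n$ and $\sum_{i}A_i\bar x_i=b$. Let $$\mathcal L_\beta(x;\mu)=\tfrac12x^\top Hx+g^\top x-\mu^\top\Big(\sum_iA_ix_i-b\Big)+\tfrac{\beta}{2}\Big\|\sum_iA_ix_i-b\Big\|^2 .$$ An iteration of randomly permuted ADMM (RPADMM) with update order $\sigma$, a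 permutation of $\{1,\dots,n\}$, maps $(x,\mu)$ to $(x',\mu')$ as follows: for $i=1,\dots,n$ in turn, $x'_{\sigma(i)}$ is a minimizer of $\mathcal L_\beta(\,\cdot\,;\mu)$ over the block $\sigma(i)$, with the blocks $\sigma(j)$, $j<i$, fixed at $x'_{\sigma(j)}$ and the blocks $\sigma(j)$, $j>i$, fixed at $x_{\sigma(j)}$; then $\mu'=\mu-\beta(\sum_iA_ix'_i-b)$. RPADMM starts at an arbitrary deterministic point $(x^0,\mu^0)$ and uses in iteration $k$ the order $\sigma_k$, where $\sigma_0,\sigma_1,\dots$ are independent and uniformly distributed on the set $\Gamma$ of all permutations of $\{1,\dots,n\}$. Let $S=H+\beta A^\top A$; for $\sigma\in\Gamma$ let $L_\sigma\in\mathbb R^{d\times d}$ have the blocks $(L_\sigma)_{\sigma(i),\sigma(j)}=S_{\sigma(i)\sigma(j)}$ if $i\ge j$ and $0$ otherwise, and put $$M_\sigma=\begin{bmatrix}L_\sigma&0\\ \beta A&I\end{bmatrix}^{-1}\begin{bmatrix}L_\sigma-S&A^\top\\0&I\end{bmatrix},\qquad M=\frac1{n!}\sum_{\sigma\in\Gamma}M_\sigma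 .$$ **Theorem.** Assume that (1) has a KKT point and that $$\operatorname{diag}(H_{11},\dots,H_{nn})+\operatorname{diag}(A_1^\top A_1,\dots,A_n^\top A_n)\succ0 .$$ Then: 1. for every order $\sigma$ and every $(x,\mu)$ the RPADMM iteration is well defined: there is exactly one $(x',\mu')$; 2. every complex eigenvalue $\lambda$ of $M$ satisfies $|\lambda|<1$ or $\lambda=1$; 3. the algebraic multiplicity of $1$ for $M$ (zero if $1$ is not an eigenvalue) equals its geometric multiplicity; 4. for every starting point, the RPADMM iterates $(x^k,\mu^k)$ are integrable for all $k$, and there is a KKT point $(\bar x,\bar\mu)$ of (1) with $\mathbb E[x^k]\to\bar x$ and $\mathbb E[\mu^k]\to\bar\mu$ as $k\to\infty$. -/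

import Mathlib

open MeasureTheory ProbabilityTheory Filter Topology

noncomputable section

/-- Index set of the coordinates of `ℝ^d`, `d = d₁ + ⋯ + dₙ`: pairs (block, coordinate in the block). -/
abbrev BlockIdx {n : ℕ} (d : Fin n → ℕ) : Type := (i : Fin n) × Fin (d i)

/-- Block vectors `x = (x₁, …, xₙ)` with `xᵢ ∈ ℝ^{dᵢ}`. -/
abbrev BlockVec {n : ℕ} (d : Fin n → ℕ) : Type := (i : Fin n) → Fin (d i) → ℝ

/-- The block vector `(x₁, …, xₙ)` read as one vector of `ℝ^d`. -/
def flat {n : ℕ} {d : Fin n → ℕ} (x : BlockVec d) : BlockIdx d → ℝ := fun p => x p.1 p.2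

/-- The objective `½ xᵀ H x + gᵀ x`. -/
def objective {n : ℕ} {d : Fin n → ℕ} (H : Matrix (BlockIdx d) (BlockIdx d) ℝ) (g : BlockVec d)
    (x : BlockVec d) : ℝ :=
  (1 / 2 : ℝ) * (flat x ⬝ᵥ H.mulVec (flat x)) + flat g ⬝ᵥ flat x

/-- The constraint residual `∑ᵢ Aᵢ xᵢ - b`. -/
def constrResidual {n m : ℕ} {d : Fin n → ℕ} (A : (i : Fin n) → Matrix (Fin m) (Fin (d i)) ℝ)
    (b : Fin m → ℝ) (x : BlockVec d) : Fin m → ℝ :=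
  ∑ i, (A i).mulVec (x i) - b

/-- The augmented Lagrangian
`½ xᵀ H x + gᵀ x - μᵀ(∑ᵢ Aᵢ xᵢ - b) + (β / 2) ‖∑ᵢ Aᵢ xᵢ - b‖²` (Euclidean norm). -/
def augLagrangian {n m : ℕ} {d : Fin n → ℕ} (H : Matrix (BlockIdx d) (BlockIdx d) ℝ)
    (g : BlockVec d) (A : (i : Fin n) → Matrix (Fin m) (Fin (d i)) ℝ) (b : Fin m → ℝ) (β : ℝ)
    (x : BlockVec d) (μ : Fin m → ℝ) : ℝ :=
  objective H g x - μ ⬝ᵥ constrResidual A b x + β / 2 * (constrResidual A b x ⬝ᵥ constrResidual A b x)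

/-- `(x, μ)` is a KKT point of `min ½ xᵀ H x + gᵀ x` subject to `∑ᵢ Aᵢ xᵢ = b`:
`-(H x + g)ᵢ + Aᵢᵀ μ = 0` for every block `i`, and `x` is feasible. -/
def IsKKT {n m : ℕ} {d : Fin n → ℕ} (H : Matrix (BlockIdx d) (BlockIdx d) ℝ)
    (g : BlockVec d) (A : (i : Fin n) → Matrix (Fin m) (Fin (d i)) ℝ) (b : Fin m → ℝ)
    (x : BlockVec d) (μ : Fin m → ℝ) : Prop :=
  (∀ i : Fin n, -(fun a => (H.mulVec (flat x) + flat g) ⟨i, a⟩) + (A i).transpose.mulVec μ = 0) ∧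
    ∑ i, (A i).mulVec (x i) = b

/-- One iteration of ADMM with update order `σ(1), …, σ(n)`, from `(x, μ)` to `(x', μ')`: the new
block `x'_{σ(i)}` minimizes the augmented Lagrangian over the block `σ(i)`, where the blocks
`σ(j)` with `j < i` are held at their new values and those with `j > i` at their old values;
then the multiplier is updated. -/
def RPADMMStep {n m : ℕ} {d : Fin n → ℕ} (H : Matrix (BlockIdx d) (BlockIdx d) ℝ)
    (g : BlockVec d) (A : (i : Fin n) → Matrix (Fin m) (Fin (d i)) ℝ) (b : Fin m → ℝ) (β : ℝ)
    (σ : Equiv.Perm (Fin n)) (x : BlockVec d) (μ : Fin m → ℝ)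
    (x' : BlockVec d) (μ' : Fin m → ℝ) : Prop :=
  (∀ i : Fin n, IsMinOn
    (fun y : Fin (d (σ i)) → ℝ => augLagrangian H g A b β
      (Function.update (fun l => if σ.symm l < i then x' l else x l) (σ i) y) μ)
    Set.univ (x' (σ i))) ∧
  μ' = μ - β • constrResidual A b x'

/-- `(xᵏ, μᵏ)` is generated by randomly permuted ADMM from the starting point `(x₀, μ₀)`:
the permutations `σ₀, σ₁, …` are independent and uniformly distributed on all permutations
of the `n` blocks, and iteration `k` uses the update order `σₖ`. -/
structure IsRPADMM {n m : ℕ} {d : Fin n → ℕ} (H : Matrix (BlockIdx d) (BlockIdx d) ℝ)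
    (g : BlockVec d) (A : (i : Fin n) → Matrix (Fin m) (Fin (d i)) ℝ) (b : Fin m → ℝ) (β : ℝ)
    {Ω : Type*} [MeasurableSpace Ω] (P : Measure Ω) (σ : ℕ → Ω → Equiv.Perm (Fin n))
    (x₀ : BlockVec d) (μ₀ : Fin m → ℝ)
    (x : ℕ → Ω → BlockVec d) (μ : ℕ → Ω → Fin m → ℝ) : Prop where
  measurable : ∀ k, Measurable[_, (⊤ : MeasurableSpace (Equiv.Perm (Fin n)))] (σ k)
  uniform : ∀ k (τ : Equiv.Perm (Fin n)), P {ω | σ k ω = τ} = ((n.factorial : ℕ) : ENNReal)⁻¹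
  indep : iIndepFun (m := fun _ => (⊤ : MeasurableSpace (Equiv.Perm (Fin n)))) σ P
  init_x : ∀ ω, x 0 ω = x₀
  init_μ : ∀ ω, μ 0 ω = μ₀
  step : ∀ k ω, RPADMMStep H g A b β (σ k ω) (x k ω) (μ k ω) (x (k + 1) ω) (μ (k + 1) ω)

/-- The matrix `A = (A₁, …, Aₙ) ∈ ℝ^{m × d}`. -/
def concatA {n m : ℕ} {d : Fin n → ℕ} (A : (i : Fin n) → Matrix (Fin m) (Fin (d i)) ℝ) :
    Matrix (Fin m) (BlockIdx d) ℝ :=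
  Matrix.of fun r p => A p.1 r p.2

/-- `S = H + β Aᵀ A`. -/
def matS {n m : ℕ} {d : Fin n → ℕ} (H : Matrix (BlockIdx d) (BlockIdx d) ℝ)
    (A : (i : Fin n) → Matrix (Fin m) (Fin (d i)) ℝ) (β : ℝ) :
    Matrix (BlockIdx d) (BlockIdx d) ℝ :=
  H + β • ((concatA A).transpose * concatA A)

/-- The matrix `L_σ`, whose block at `(σ(i), σ(j))` is that of `S` if `i ≥ j`, and `0` otherwise. -/
def matL {n m : ℕ} {d : Fin n → ℕ} (H : Matrix (BlockIdx d) (BlockIdx d) ℝ)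
    (A : (i : Fin n) → Matrix (Fin m) (Fin (d i)) ℝ) (β : ℝ) (σ : Equiv.Perm (Fin n)) :
    Matrix (BlockIdx d) (BlockIdx d) ℝ :=
  Matrix.of fun p q => if σ.symm q.1 ≤ σ.symm p.1 then matS H A β p q else 0

/-- The update matrix for the order `σ`: the inverse of `[[L_σ, 0], [β A, I]]`
times `[[L_σ - S, Aᵀ], [0, I]]`. -/
def updateMatrix {n m : ℕ} {d : Fin n → ℕ} (H : Matrix (BlockIdx d) (BlockIdx d) ℝ)
    (A : (i : Fin n) → Matrix (Fin m) (Fin (d i)) ℝ) (β : ℝ) (σ : Equiv.Perm (Fin n)) :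
    Matrix (BlockIdx d ⊕ Fin m) (BlockIdx d ⊕ Fin m) ℝ :=
  (Matrix.fromBlocks (matL H A β σ) 0 (β • concatA A) 1)⁻¹ *
    Matrix.fromBlocks (matL H A β σ - matS H A β) (concatA A).transpose 0 1

/-- The expected update matrix: the average of the update matrices over all permutations. -/
def expectedUpdateMatrix {n m : ℕ} {d : Fin n → ℕ} (H : Matrix (BlockIdx d) (BlockIdx d) ℝ)
    (A : (i : Fin n) → Matrix (Fin m) (Fin (d i)) ℝ) (β : ℝ) :
    Matrix (BlockIdx d ⊕ Fin m) (BlockIdx d ⊕ Fin m) ℝ :=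
  ((n.factorial : ℕ) : ℝ)⁻¹ • ∑ σ : Equiv.Perm (Fin n), updateMatrix H A β σ

end

/-! Subtracting a KKT point turns one iteration into the linear map `M_σ`, which is affine in
`L_σ⁻¹`. Hence `M` has the same form with `L_σ⁻¹` replaced by the average `Q` of these inverses
(`expectedUpdateMatrix_eq`). Reversing an order transposes `L_σ`, so `Q` is symmetric; `L_σ + L_σᵀ =
S + D`, with `D` the block diagonal of `S`, makes it positive definite.

The core is the bound `QSQ ≺ (4/3) Q` (`dotProduct_avgInv_lt`). With `S = BᵀB`, each `I - B L_σ⁻¹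
Bᵀ` is a product of orthogonal projections in the order `σ`, and the average of such products over
all orders exceeds `-1/3` (`inner_permProdSum_pos`).

For an eigenvalue `λ = 1 - t ≠ 1`, eliminating the multiplier gives `t² q = t h + (2t - 1) a` with
`q > 0`, `h, a ≥ 0` and `h + a < (4/3) q`, whence `|λ| < 1`. Positivity of `Q` and `H ⪰ 0` exclude
Jordan chains at `1`. Powers of `M` therefore converge to a projection onto its fixed vectors, which
are the solutions of the homogeneous KKT system. Independence makes the expected error at step `k`
equal to `Mᵏ` times the initial error. -/

/-! ### Averages of products of orthogonal projections over all orders. -/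

section PermutedProjections

variable {E : Type*} [NormedAddCommGroup E] [InnerProductSpace ℝ E]

/-- The sum over all orderings of the products of a finite family of endomorphisms. -/
noncomputable def permProdSum {n : ℕ} (P : Fin n → Module.End ℝ E) : Module.End ℝ E :=
  ∑ σ : Equiv.Perm (Fin n), (List.ofFn fun i => P (σ i)).prod

lemma inner_prod_ofFn {n : ℕ} (P : Fin n → Module.End ℝ E) (hP : ∀ i, (P i).IsSymmetric) (u v : E) :
    inner ℝ ((List.ofFn P).prod u) v = inner ℝ u ((List.ofFn fun i => P i.rev).prod v) := by
  induction n generalizing u v with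
  | zero => simp
  | succ n ih =>
    rw [List.ofFn_succ, List.ofFn_succ', List.prod_cons, List.concat_eq_append, List.prod_append]
    simp only [Module.End.mul_apply, Fin.rev_last, List.prod_cons, List.prod_nil, mul_one]
    rw [hP 0, ih (fun i => P i.succ) (fun i => hP _)]
    simp [Fin.rev_castSucc]

lemma norm_prod_ofFn_le {n : ℕ} (P : Fin n → Module.End ℝ E) (hP : ∀ i v, ‖P i v‖ ≤ ‖v‖) (v : E) :
    ‖(List.ofFn P).prod v‖ ≤ ‖v‖ := by
  induction n with
  | zero => simp
  | succ n ih =>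
    rw [List.ofFn_succ, List.prod_cons, Module.End.mul_apply]
    exact (hP _ _).trans (ih _ fun i => hP _)

lemma permProdSum_rev {n : ℕ} (P : Fin n → Module.End ℝ E) :
    ∑ σ : Equiv.Perm (Fin n), (List.ofFn fun i => P (σ i.rev)).prod = permProdSum P :=
  Fintype.sum_equiv (Equiv.mulRight Fin.revPerm) _ _ fun σ => by simp

/-- The adjoint of a product is the product in reverse order, and reversal permutes the set of
orders. -/
lemma permProdSum_isSymmetric {n : ℕ} (P : Fin n → Module.End ℝ E)
    (hP : ∀ i, (P i).IsSymmetric) : (permProdSum P).IsSymmetric := by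
  intro u v
  conv_rhs => rw [← permProdSum_rev]
  rw [permProdSum, LinearMap.sum_apply, LinearMap.sum_apply, sum_inner, inner_sum]
  exact Finset.sum_congr rfl fun σ _ => inner_prod_ofFn (fun i => P (σ i)) (fun i => hP _) u v

lemma inner_permProdSum_le {n : ℕ} (P : Fin n → Module.End ℝ E) (hP : ∀ i v, ‖P i v‖ ≤ ‖v‖)
    (v : E) : inner ℝ v (permProdSum P v) ≤ n.factorial * inner ℝ v v := by
  rw [permProdSum, LinearMap.sum_apply, inner_sum]
  refine (Finset.sum_le_sum (g := fun _ => inner ℝ v v) fun σ _ => ?_).trans ?_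
  · refine (real_inner_le_norm _ _).trans ?_
    rw [real_inner_self_eq_norm_mul_norm]
    exact mul_le_mul_of_nonneg_left (norm_prod_ofFn_le _ (fun i => hP _) v) (norm_nonneg v)
  · simp [Fintype.card_perm]

/-- The orders are sorted by their leading index `p`; `i ↦ swap 0 p i.succ` enumerates the remaining
indices. -/
lemma permProdSum_succ {n : ℕ} (P : Fin (n + 1) → Module.End ℝ E) :
    permProdSum P =
      ∑ p, P p * permProdSum fun i => P (Equiv.swap 0 p i.succ) := by
  unfold permProdSum
  simp_rw [Finset.mul_sum]
  rw [← Fintype.sum_prod_type'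
    (f := fun (p : Fin (n + 1)) (σ : Equiv.Perm (Fin n)) =>
      P p * (List.ofFn fun i => P (Equiv.swap 0 p (σ i).succ)).prod)]
  refine Fintype.sum_equiv Equiv.Perm.decomposeFin _ _ fun σ => ?_
  obtain ⟨⟨p, e⟩, rfl⟩ := Equiv.Perm.decomposeFin.symm.surjective σ
  rw [List.ofFn_succ, List.prod_cons, Equiv.apply_symm_apply]
  simp

/-- One step of the induction: composing with one more projection and symmetrizing preserves the
lower bound `-1/3`. -/
lemma inner_proj_comp_pos {F P : Module.End ℝ E} {c : ℝ} (hF : F.IsSymmetric)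
    (hFle : ∀ v, inner ℝ v (F v) ≤ c * inner ℝ v v)
    (hFpos : ∀ v, v ≠ 0 → 0 < inner ℝ v (F v) + c / 3 * inner ℝ v v)
    (hP : P.IsSymmetricProjection) {v : E} (hv : v ≠ 0) :
    0 < inner ℝ v (P (F v)) + c / 3 * inner ℝ v v := by
  have hwp : inner ℝ (P v) (v - P v) = 0 := by
    have : P (P v) = P v := by
      rw [← Module.End.mul_apply, hP.isIdempotentElem.eq]
    rw [inner_sub_right, ← hP.isSymmetric (P v) v, this, sub_self]
  have hsplit : v = P v + (v - P v) := by abel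
  set w := P v
  set p := v - w
  rw [← hP.isSymmetric v]
  change 0 < inner ℝ w (F v) + _
  have hsym : inner ℝ p (F w) = inner ℝ w (F p) := by
    rw [← hF p w, real_inner_comm]
  have hpw : inner ℝ p w = 0 := by rw [real_inner_comm]; exact hwp
  -- The lower bound is tested at `w + p/2`, because its cross term is exactly the wanted `⟪w, F
  -- p⟫`. The remainder `¼⟪p, F p⟫` is at most `(c/4)‖p‖²`, and `1/4 + 1/12 = 1/3` reproduces the
  -- constant.
  have hne : w + (1 / 2 : ℝ) • p ≠ 0 := by
    intro h0
    have h1 : inner ℝ w (w + (1 / 2 : ℝ) • p) = 0 := by rw [h0, inner_zero_right]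
    rw [inner_add_right, inner_smul_right, hwp, mul_zero, add_zero, inner_self_eq_zero] at h1
    have h2 : p = 0 := by simpa [h1] using h0
    exact hv (by rw [hsplit, h1, h2, add_zero])
  have h1 := hFpos _ hne
  have h2 := hFle p
  rw [hsplit]
  simp only [map_add, map_smul, inner_add_left, inner_add_right, inner_smul_left,
    inner_smul_right, hsym, hpw, hwp] at h1 ⊢
  simp only [conj_trivial] at h1
  linarith

/-- Induction on the number of projections: each group of orders with a common leading index
satisfies the bound separately, by `inner_proj_comp_pos` with `c = n!`. -/
theorem inner_permProdSum_pos {n : ℕ} (P : Fin n → Module.End ℝ E)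
    (hP : ∀ i, (P i).IsSymmetricProjection) (hPn : ∀ i v, ‖P i v‖ ≤ ‖v‖) {v : E} (hv : v ≠ 0) :
    0 < inner ℝ v (permProdSum P v) + n.factorial / 3 * inner ℝ v v := by
  induction n generalizing v with
  | zero =>
    have : 0 < inner ℝ v v := real_inner_self_pos.2 hv
    simp [permProdSum]
    positivity
  | succ n ih =>
    rw [permProdSum_succ, LinearMap.sum_apply, inner_sum]
    have hc : (((n + 1).factorial : ℕ) : ℝ) / 3 * inner ℝ v v =
        ∑ _p : Fin (n + 1), (n.factorial : ℝ) / 3 * inner ℝ v v := by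
      simp [Nat.factorial_succ]; ring
    rw [hc, ← Finset.sum_add_distrib]
    refine Finset.sum_pos (fun p _ => ?_) Finset.univ_nonempty
    exact inner_proj_comp_pos (permProdSum_isSymmetric _ fun i => (hP _).isSymmetric)
      (inner_permProdSum_le _ fun i => hPn _) (fun u hu => ih _ (fun i => hP _) (fun i => hPn _) hu)
      (hP p) hv

/-- The rightmost factor acts first, so a chain run in the order `0, 1, …` is the product in
reversed order. -/
lemma prod_ofFn_rev_apply {n : ℕ} (T : Fin n → Module.End ℝ E) (w : Fin (n + 1) → E)
    (h : ∀ i : Fin n, w i.succ = T i (w i.castSucc)) :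
    (List.ofFn fun i => T i.rev).prod (w 0) = w (Fin.last n) := by
  induction n with
  | zero => simp
  | succ n ih =>
    rw [List.ofFn_succ, List.prod_cons, Module.End.mul_apply]
    have := ih (fun i => T i.castSucc) (fun i => w i.castSucc) fun i => by
      simpa using h i.castSucc
    simp only [Fin.rev_succ, Fin.rev_zero, Fin.castSucc_zero] at this ⊢
    rw [this, ← Fin.succ_last, h]

end PermutedProjections

/-! ### Block triangular parts, Gauss–Seidel sweeps and the bound `QSQ ≺ (4/3) Q`. -/

section BlockTriangular

open Matrix

variable {n : ℕ} {d : Fin n → ℕ} {S : Matrix (BlockIdx d) (BlockIdx d) ℝ}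

/-- The block lower triangular part of `S` with respect to the order `σ` of the blocks. -/
noncomputable def blockLower (S : Matrix (BlockIdx d) (BlockIdx d) ℝ) (σ : Equiv.Perm (Fin n)) :
    Matrix (BlockIdx d) (BlockIdx d) ℝ :=
  Matrix.of fun p q => if σ.symm q.1 ≤ σ.symm p.1 then S p q else 0

/-- The block diagonal part of `S`, as a matrix of the same size. -/
noncomputable def blockDiagPart (S : Matrix (BlockIdx d) (BlockIdx d) ℝ) : Matrix (BlockIdx d) (BlockIdx d) ℝ :=
  Matrix.of fun p q => if p.1 = q.1 then S p q else 0

/-- The average of the inverses of the block lower triangular parts of `S` over all orders. -/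
noncomputable def avgInv (S : Matrix (BlockIdx d) (BlockIdx d) ℝ) : Matrix (BlockIdx d) (BlockIdx d) ℝ :=
  ((n.factorial : ℕ) : ℝ)⁻¹ • ∑ σ : Equiv.Perm (Fin n), (blockLower S σ)⁻¹

lemma blockLower_transpose (hS : Sᵀ = S) (σ : Equiv.Perm (Fin n)) :
    (blockLower S σ)ᵀ = blockLower S (σ * Fin.revPerm) := by
  ext p q
  have h1 : S q p = S p q := congrFun (congrFun hS p) q
  have h2 : ∀ i, (σ * Fin.revPerm).symm i = (σ.symm i).rev := fun i => by
    rw [Equiv.symm_apply_eq]; simp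
  simp [blockLower, h1, h2]

lemma blockLower_add_transpose (hS : Sᵀ = S) (σ : Equiv.Perm (Fin n)) :
    blockLower S σ + (blockLower S σ)ᵀ = S + blockDiagPart S := by
  ext p q
  have h1 : S q p = S p q := congrFun (congrFun hS p) q
  simp only [blockLower, blockDiagPart, Matrix.add_apply, transpose_apply, of_apply, h1]
  rcases lt_trichotomy (σ.symm p.1) (σ.symm q.1) with h | h | h
  · have : p.1 ≠ q.1 := fun h' => by simp [h'] at h
    simp [h.le, not_le.2 h, this]
  · simp [σ.symm.injective h]
  · have : p.1 ≠ q.1 := fun h' => by simp [h'] at h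
    simp [h.le, not_le.2 h, this]

lemma dotProduct_transpose_mulVec_self {ι : Type*} [Fintype ι] (N : Matrix ι ι ℝ) (v : ι → ℝ) :
    v ⬝ᵥ Nᵀ *ᵥ v = v ⬝ᵥ N *ᵥ v := by
  rw [mulVec_transpose, dotProduct_comm, ← dotProduct_mulVec]

/-- The symmetric part of `blockLower S σ` is half of `S` plus its block diagonal. -/
lemma blockLower_pos (hS : S.PosSemidef) (hD : ∀ v, v ≠ 0 → 0 < v ⬝ᵥ blockDiagPart S *ᵥ v)
    (σ : Equiv.Perm (Fin n)) {v : BlockIdx d → ℝ} (hv : v ≠ 0) :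
    0 < v ⬝ᵥ blockLower S σ *ᵥ v := by
  have hSt : Sᵀ = S := by simpa using hS.1.eq
  have h1 := congrArg (fun N => v ⬝ᵥ N *ᵥ v) (blockLower_add_transpose hSt σ)
  simp only [add_mulVec, dotProduct_add, dotProduct_transpose_mulVec_self] at h1
  have h2 : 0 ≤ v ⬝ᵥ S *ᵥ v := by simpa using hS.dotProduct_mulVec_nonneg v
  have h3 := hD v hv
  linarith

lemma isUnit_of_dotProduct_mulVec_pos {ι : Type*} [Fintype ι] [DecidableEq ι] {N : Matrix ι ι ℝ}
    (h : ∀ v, v ≠ 0 → 0 < v ⬝ᵥ N *ᵥ v) : IsUnit N := by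
  rw [← mulVec_injective_iff_isUnit]
  refine (injective_iff_map_eq_zero N.mulVecLin).2 ?_
  intro v hv
  by_contra h0
  have := h v h0
  rw [show N *ᵥ v = 0 from hv] at this
  simp at this

lemma isUnit_blockLower (hS : S.PosSemidef)
    (hD : ∀ v, v ≠ 0 → 0 < v ⬝ᵥ blockDiagPart S *ᵥ v) (σ : Equiv.Perm (Fin n)) :
    IsUnit (blockLower S σ) :=
  isUnit_of_dotProduct_mulVec_pos fun _ hv => blockLower_pos hS hD σ hv

lemma blockLower_mulVec_inv (hS : S.PosSemidef)
    (hD : ∀ v, v ≠ 0 → 0 < v ⬝ᵥ blockDiagPart S *ᵥ v) (σ : Equiv.Perm (Fin n))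
    (v : BlockIdx d → ℝ) : blockLower S σ *ᵥ ((blockLower S σ)⁻¹ *ᵥ v) = v := by
  rw [mulVec_mulVec, mul_nonsing_inv _ ((isUnit_iff_isUnit_det _).1 (isUnit_blockLower hS hD σ)),
    one_mulVec]

lemma avgInv_transpose (hS : S.PosSemidef) : (avgInv S)ᵀ = avgInv S := by
  have hSt : Sᵀ = S := by simpa using hS.1.eq
  simp only [avgInv, transpose_smul, transpose_sum, transpose_nonsing_inv,
    blockLower_transpose hSt]
  congr 1
  exact Fintype.sum_equiv (Equiv.mulRight Fin.revPerm) _ _ fun σ => rfl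

/-- Substituting `v = L u` turns `v ⬝ᵥ L⁻¹ v` into `u ⬝ᵥ L u > 0`, for each order. -/
lemma avgInv_pos (hS : S.PosSemidef) (hD : ∀ v, v ≠ 0 → 0 < v ⬝ᵥ blockDiagPart S *ᵥ v)
    {v : BlockIdx d → ℝ} (hv : v ≠ 0) : 0 < v ⬝ᵥ avgInv S *ᵥ v := by
  rw [avgInv, smul_mulVec, sum_mulVec, dotProduct_smul, dotProduct_sum, smul_eq_mul]
  refine mul_pos (by positivity) (Finset.sum_pos (fun σ _ => ?_) Finset.univ_nonempty)
  have h := blockLower_mulVec_inv hS hD σ v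
  have hne : (blockLower S σ)⁻¹ *ᵥ v ≠ 0 := fun h0 => hv (by rw [← h, h0, mulVec_zero])
  have := blockLower_pos hS hD σ hne
  rwa [h, dotProduct_comm] at this

/-- The orthogonal projection onto the complement of the span of the columns of block `i`. -/
noncomputable def blockProj {ι : Type*} [Fintype ι] (B : Matrix ι (BlockIdx d) ℝ) (i : Fin n) :
    Module.End ℝ (EuclideanSpace ℝ ι) :=
  (Submodule.span ℝ (Set.range fun a : Fin (d i) => WithLp.toLp 2 (B.col ⟨i, a⟩)))ᗮ.starProjection

lemma blockProj_isSymmetricProjection {ι : Type*} [Fintype ι] (B : Matrix ι (BlockIdx d) ℝ)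
    (i : Fin n) : (blockProj B i).IsSymmetricProjection :=
  Submodule.isSymmetricProjection_starProjection _

lemma norm_blockProj_le {ι : Type*} [Fintype ι] (B : Matrix ι (BlockIdx d) ℝ)
    (i : Fin n) (v : EuclideanSpace ℝ ι) : ‖blockProj B i v‖ ≤ ‖v‖ :=
  Submodule.norm_starProjection_apply_le _ v

/-- A block Gauss–Seidel sweep is a product of orthogonal projections. -/
lemma gaussSeidel_eq_prod {ι : Type*} [Fintype ι] {B : Matrix ι (BlockIdx d) ℝ}
    (σ : Equiv.Perm (Fin n)) {v : ι → ℝ} {u : BlockIdx d → ℝ}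
    (hu : blockLower (Bᵀ * B) σ *ᵥ u = Bᵀ *ᵥ v) :
    (List.ofFn fun i => blockProj B (σ i.rev)).prod (WithLp.toLp 2 v) =
      WithLp.toLp 2 (v - B *ᵥ u) := by
  -- `r k` keeps the first `k` blocks of `u` in the order `σ`, and `w k` is the residual after `k`
  -- block updates. Block row `σ i` of the triangular system says that `w i.succ` is orthogonal to
  -- the columns of that block, while `w i.castSucc - w i.succ` lies in their span.
  let r : Fin (n + 1) → BlockIdx d → ℝ := fun k p => if (σ.symm p.1).castSucc < k then u p else 0
  let w : Fin (n + 1) → EuclideanSpace ℝ ι := fun k => WithLp.toLp 2 (v - B *ᵥ r k)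
  have h0 : r 0 = 0 := by ext p; simp [r]
  have h1 : r (Fin.last n) = u := by ext p; simp [r, Fin.castSucc_lt_last]
  have hmain := prod_ofFn_rev_apply (fun i => blockProj B (σ i)) w fun i => ?_
  · simpa [w, h0, h1] using hmain
  refine (Submodule.eq_starProjection_of_mem_orthogonal ?_ ?_).symm
  · rw [Submodule.mem_orthogonal]
    intro z hz
    induction hz using Submodule.span_induction with
    | zero => simp
    | add _ _ _ _ h1 h2 => rw [inner_add_left, h1, h2, add_zero]
    | smul c _ _ h => rw [inner_smul_left, h, mul_zero]
    | mem z hz =>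
      obtain ⟨a, rfl⟩ := hz
      have h2 := congrFun hu ⟨σ i, a⟩
      have h3 : (blockLower (Bᵀ * B) σ *ᵥ u) ⟨σ i, a⟩ = (Bᵀ *ᵥ (B *ᵥ r i.succ)) ⟨σ i, a⟩ := by
        rw [mulVec_mulVec]
        refine Finset.sum_congr rfl fun q _ => ?_
        simp [blockLower, r, Fin.castSucc_lt_succ_iff]
      have h4 : (Bᵀ *ᵥ (v - B *ᵥ r i.succ)) ⟨σ i, a⟩ = 0 := by
        rw [mulVec_sub, Pi.sub_apply, ← h2, h3, sub_self]
      rw [← h4, EuclideanSpace.inner_eq_star_dotProduct]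
      simp [w, mulVec, dotProduct, mul_comm]
  · refine Submodule.le_orthogonal_orthogonal _ ?_
    have h2 : w i.castSucc - w i.succ =
        ∑ a, u ⟨σ i, a⟩ • WithLp.toLp 2 (B.col ⟨σ i, a⟩) := by
      ext c
      have h3 : r i.succ = r i.castSucc + fun p => if p.1 = σ i then u p else 0 := by
        ext p
        simp only [r, Fin.castSucc_lt_succ_iff, Pi.add_apply, Fin.castSucc_lt_castSucc_iff]
        rcases lt_trichotomy (σ.symm p.1) i with h | h | h
        · have : p.1 ≠ σ i := fun h' => by simp [h'] at h
          simp [h, h.le, this]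
        · have : p.1 = σ i := by rw [← h]; simp
          simp [this]
        · have : p.1 ≠ σ i := fun h' => by simp [h'] at h
          simp [not_le.2 h, not_lt.2 h.le, this]
      simp only [w, h3, mulVec_add]
      simp [mulVec, dotProduct, Fintype.sum_sigma, mul_comm]
      rw [Finset.sum_eq_single (σ i)] <;> simp +contextual
    rw [h2]
    exact Submodule.sum_mem _ fun a _ => Submodule.smul_mem _ _ (Submodule.subset_span ⟨a, rfl⟩)

/-- Averaging `I - B L_σ⁻¹ Bᵀ` over `σ` gives `I - B Q Bᵀ ≻ -1/3`. -/
lemma avgInv_conj_lt {ι : Type*} [Fintype ι] {B : Matrix ι (BlockIdx d) ℝ}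
    (hS : (Bᵀ * B).PosSemidef)
    (hD : ∀ v, v ≠ 0 → 0 < v ⬝ᵥ blockDiagPart (Bᵀ * B) *ᵥ v) {v : ι → ℝ} (hv : v ≠ 0) :
    v ⬝ᵥ B *ᵥ (avgInv (Bᵀ * B) *ᵥ (Bᵀ *ᵥ v)) < 4 / 3 * (v ⬝ᵥ v) := by
  have h1 := inner_permProdSum_pos (blockProj B) (blockProj_isSymmetricProjection B)
    (norm_blockProj_le B) (v := WithLp.toLp 2 v) (by simpa using hv)
  rw [← permProdSum_rev, LinearMap.sum_apply, inner_sum] at h1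
  have h2 : ∀ σ : Equiv.Perm (Fin n), inner ℝ (WithLp.toLp 2 v)
      ((List.ofFn fun i => blockProj B (σ i.rev)).prod (WithLp.toLp 2 v)) =
      v ⬝ᵥ v - v ⬝ᵥ B *ᵥ ((blockLower (Bᵀ * B) σ)⁻¹ *ᵥ (Bᵀ *ᵥ v)) := fun σ => by
    rw [gaussSeidel_eq_prod σ (blockLower_mulVec_inv hS hD σ (Bᵀ *ᵥ v)),
      EuclideanSpace.inner_eq_star_dotProduct]
    simp [dotProduct_comm _ v, dotProduct_sub]
  simp_rw [h2] at h1
  rw [EuclideanSpace.inner_eq_star_dotProduct] at h1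
  simp only [Finset.sum_sub_distrib, Finset.sum_const, Finset.card_univ, Fintype.card_perm,
    Fintype.card_fin, nsmul_eq_mul, star_trivial] at h1
  rw [avgInv, smul_mulVec, sum_mulVec, mulVec_smul, mulVec_sum, dotProduct_smul, dotProduct_sum,
    smul_eq_mul]
  have hf : (0 : ℝ) < n.factorial := by positivity
  rw [inv_mul_lt_iff₀ hf]
  linarith

/-- The spectral bound `ρ(QS) < 4/3`, as an inequality between quadratic forms. -/
theorem dotProduct_avgInv_lt (hS : S.PosSemidef)
    (hD : ∀ v, v ≠ 0 → 0 < v ⬝ᵥ blockDiagPart S *ᵥ v) {y : BlockIdx d → ℝ} (hy : y ≠ 0) :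
    (avgInv S *ᵥ y) ⬝ᵥ S *ᵥ (avgInv S *ᵥ y) < 4 / 3 * (y ⬝ᵥ avgInv S *ᵥ y) := by
  obtain ⟨B, hB⟩ : ∃ B : Matrix (BlockIdx d) (BlockIdx d) ℝ, S = Bᵀ * B := by
    open scoped MatrixOrder in
    obtain ⟨B, hB⟩ := CStarAlgebra.nonneg_iff_eq_star_mul_self.mp hS.nonneg
    exact ⟨B, by simpa [star_eq_conjTranspose] using hB⟩
  subst hB
  have hQt := avgInv_transpose hS
  have hQp := avgInv_pos hS hD hy
  have hSy : ∀ x : BlockIdx d → ℝ, x ⬝ᵥ (Bᵀ * B) *ᵥ x = (B *ᵥ x) ⬝ᵥ (B *ᵥ x) := fun x => by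
    rw [← mulVec_mulVec, dotProduct_mulVec, vecMul_transpose]
  rw [hSy]
  set Q := avgInv (Bᵀ * B) with hQ
  set e := B *ᵥ (Q *ᵥ y) with he
  by_cases he0 : e = 0
  · rw [he0, zero_dotProduct]; positivity
  have h1 := avgInv_conj_lt hS hD he0
  rw [← hQ] at h1
  -- Transfers `B Q Bᵀ ≺ 4/3` to `QSQ ≺ (4/3) Q`: with `e = B Q y`, the square expands to `yᵀQy -
  -- (3/2)‖e‖² + (9/16) eᵀBQBᵀe`, which is less than `yᵀQy - (3/4)‖e‖²`.
  have h2 : 0 ≤ (y - (3 / 4 : ℝ) • (Bᵀ *ᵥ e)) ⬝ᵥ Q *ᵥ (y - (3 / 4 : ℝ) • (Bᵀ *ᵥ e)) := by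
    by_cases h0 : y - (3 / 4 : ℝ) • (Bᵀ *ᵥ e) = 0
    · rw [h0, zero_dotProduct]
    · exact (avgInv_pos hS hD h0).le
  have h3 : (Bᵀ *ᵥ e) ⬝ᵥ Q *ᵥ y = e ⬝ᵥ e := by
    rw [mulVec_transpose, ← dotProduct_mulVec]
  have h4 : y ⬝ᵥ Q *ᵥ (Bᵀ *ᵥ e) = e ⬝ᵥ e := by
    rw [dotProduct_mulVec, ← mulVec_transpose, hQt, dotProduct_comm, h3]
  have h5 : (Bᵀ *ᵥ e) ⬝ᵥ Q *ᵥ (Bᵀ *ᵥ e) = e ⬝ᵥ B *ᵥ (Q *ᵥ (Bᵀ *ᵥ e)) := by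
    conv_lhs => rw [mulVec_transpose, ← dotProduct_mulVec, ← mulVec_transpose]
  simp only [mulVec_sub, mulVec_smul, sub_dotProduct, dotProduct_sub, smul_dotProduct,
    dotProduct_smul, smul_eq_mul, h3, h4, h5] at h2
  linarith

end BlockTriangular

/-! ### Convergence of matrix powers when the eigenvalue `1` is semisimple. -/

section PowerConvergence

open Matrix

variable {ι : Type*} [Fintype ι]

lemma map_ofReal_mulVec_re {κ : Type*} (M : Matrix κ ι ℝ) (z : ι → ℂ) (i : κ) :
    ((M.map (algebraMap ℝ ℂ) *ᵥ z) i).re = (M *ᵥ fun j => (z j).re) i := by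
  simp [mulVec, dotProduct]

lemma map_ofReal_mulVec_im {κ : Type*} (M : Matrix κ ι ℝ) (z : ι → ℂ) (i : κ) :
    ((M.map (algebraMap ℝ ℂ) *ᵥ z) i).im = (M *ᵥ fun j => (z j).im) i := by
  simp [mulVec, dotProduct]

lemma map_ofReal_mulVec_eq_iff {κ : Type*} (M : Matrix κ ι ℝ) (z : ι → ℂ) (w : κ → ℂ) :
    M.map (algebraMap ℝ ℂ) *ᵥ z = w ↔
      (M *ᵥ fun j => (z j).re) = (fun j => (w j).re) ∧
        (M *ᵥ fun j => (z j).im) = fun j => (w j).im := by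
  simp only [funext_iff, Complex.ext_iff, map_ofReal_mulVec_re, map_ofReal_mulVec_im, forall_and]

variable [DecidableEq ι]

lemma exists_mulVec_eq_smul_of_mem_spectrum {N : Matrix ι ι ℂ} {z : ℂ} (hz : z ∈ spectrum ℂ N) :
    ∃ v, v ≠ 0 ∧ N *ᵥ v = z • v := by
  rw [← spectrum_toLin', ← Module.End.hasEigenvalue_iff_mem_spectrum] at hz
  obtain ⟨v, hv⟩ := hz.exists_hasEigenvector
  exact ⟨v, hv.2, by simpa using hv.apply_eq_smul⟩

lemma mem_spectrum_of_mulVec_eq_smul {N : Matrix ι ι ℂ} {z : ℂ} {v : ι → ℂ} (hv : v ≠ 0)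
    (h : N *ᵥ v = z • v) : z ∈ spectrum ℂ N := by
  rw [← spectrum_toLin', ← Module.End.hasEigenvalue_iff_mem_spectrum]
  exact Module.End.hasEigenvalue_of_hasEigenvector
    ⟨Module.End.mem_eigenspace_iff.2 (by simpa using h), hv⟩

-- Gelfand's formula: for some `r < 1`, eventually `‖Nᵏ‖ ≤ rᵏ`.
open scoped Matrix.Norms.Operator in
lemma tendsto_pow_mulVec_zero {N : Matrix ι ι ℂ} (hN : ∀ z ∈ spectrum ℂ N, ‖z‖ < 1) (v : ι → ℂ) :
    Tendsto (fun k : ℕ => N ^ k *ᵥ v) atTop (𝓝 0) := by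
  cases isEmpty_or_nonempty ι
  · simp [Subsingleton.elim _ (0 : ι → ℂ)]
  have h1 : spectralRadius ℂ N < ((1 : NNReal) : ENNReal) :=
    spectrum.spectralRadius_lt_of_forall_lt N fun z hz => by
      rw [← NNReal.coe_lt_coe]; simpa using hN z hz
  obtain ⟨r, hr, hr1⟩ := ENNReal.lt_iff_exists_nnreal_btwn.1 h1
  rw [ENNReal.coe_lt_coe] at hr1
  have h2 := (spectrum.pow_nnnorm_pow_one_div_tendsto_nhds_spectralRadius N).eventually_lt_const hr
  have h3 : ∀ᶠ k : ℕ in atTop, ‖N ^ k *ᵥ v‖ ≤ (r : ℝ) ^ k * ‖v‖ := by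
    filter_upwards [h2, eventually_gt_atTop 0] with k hk hk0
    have hk0' : (k : ℝ) ≠ 0 := by positivity
    have h4 : (‖N ^ k‖₊ : ENNReal) ≤ (r : ENNReal) ^ k := by
      have := ENNReal.rpow_le_rpow hk.le (Nat.cast_nonneg k)
      rwa [← ENNReal.rpow_mul, one_div, inv_mul_cancel₀ hk0', ENNReal.rpow_one,
        ENNReal.rpow_natCast] at this
    have h5 : ‖N ^ k‖ ≤ (r : ℝ) ^ k := by
      rw [← ENNReal.coe_pow, ENNReal.coe_le_coe] at h4
      exact_mod_cast h4
    exact (linfty_opNorm_mulVec _ _).trans (mul_le_mul_of_nonneg_right h5 (norm_nonneg v))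
  refine squeeze_zero_norm' h3 ?_
  simpa using (tendsto_pow_atTop_nhds_zero_of_lt_one r.2 (by exact_mod_cast hr1)).mul_const ‖v‖

/-- If the eigenvalues of `M` other than `1` have modulus less than `1` and the eigenvalue `1` is
semisimple, the orbits of `M` converge to fixed points. -/
theorem exists_tendsto_pow_mulVec (M : Matrix ι ι ℝ)
    (hM : ∀ z ∈ spectrum ℂ (M.map (algebraMap ℝ ℂ)), ‖z‖ < 1 ∨ z = 1)
    (hss : ∀ v, (M - 1) *ᵥ ((M - 1) *ᵥ v) = 0 → (M - 1) *ᵥ v = 0) (v : ι → ℝ) :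
    ∃ w, M *ᵥ w = w ∧ Tendsto (fun k : ℕ => M ^ k *ᵥ v) atTop (𝓝 w) := by
  set f := (M - 1).mulVecLin with hf
  have hdisj : Disjoint (LinearMap.ker f) (LinearMap.range f) := by
    rw [Submodule.disjoint_def]
    rintro x hx ⟨y, rfl⟩
    exact hss y hx
  have hc : IsCompl (LinearMap.ker f) (LinearMap.range f) :=
    ⟨hdisj, codisjoint_iff.2 <| Submodule.eq_top_of_disjoint _ _
      (by rw [add_comm, LinearMap.finrank_range_add_finrank_ker]) hdisj⟩
  set p := (LinearMap.ker f).projection (LinearMap.range f) hc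
  set P := LinearMap.toMatrix' p
  have hP : ∀ x, P *ᵥ x = p x := fun x => LinearMap.toMatrix'_mulVec p x
  have hker : ∀ x, M *ᵥ x = x → P *ᵥ x = x := fun x hx => by
    rw [hP]
    refine Submodule.projection_apply_of_mem_left hc ?_
    simp [hf, hx]
  have hMP : ∀ x, M *ᵥ (P *ᵥ x) = P *ᵥ x := fun x => by
    have h1 : f (p x) = 0 := Submodule.projection_apply_mem hc x
    rw [hP]
    simpa [hf, sub_mulVec, sub_eq_zero] using h1
  have hPM : ∀ x, P *ᵥ (M *ᵥ x) = P *ᵥ x := fun x => by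
    have h1 : p (f x) = 0 := by
      rw [Submodule.projection_apply_eq_zero_iff]; exact ⟨x, rfl⟩
    rw [← hP] at h1
    simpa [hf, sub_mulVec, mulVec_sub, sub_eq_zero] using h1
  have hPP : ∀ x, P *ᵥ (P *ᵥ x) = P *ᵥ x := fun x => hker _ (hMP x)
  refine ⟨P *ᵥ v, hMP v, ?_⟩
  -- `P` is the projection onto the fixed vectors along the range of `M - 1`, and `MP = PM = P² =
  -- P`. Removing it from `M` leaves a matrix of spectral radius below `1`.
  set N := M - P
  have hpow : ∀ k : ℕ, M ^ k *ᵥ v - P *ᵥ v = N ^ k *ᵥ (v - P *ᵥ v) := by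
    have hPk : ∀ k : ℕ, P *ᵥ (M ^ k *ᵥ v) = P *ᵥ v := by
      intro k
      induction k with
      | zero => simp
      | succ k ih => rw [pow_succ', ← mulVec_mulVec, hPM, ih]
    intro k
    induction k with
    | zero => simp
    | succ k ih =>
      rw [pow_succ' N, ← mulVec_mulVec, ← ih, pow_succ', ← mulVec_mulVec]
      simp only [N, sub_mulVec, mulVec_sub, hMP, hPP, hPk]
      abel
  have hNspec : ∀ z ∈ spectrum ℂ (N.map (algebraMap ℝ ℂ)), ‖z‖ < 1 := by
    intro z hz
    obtain ⟨u, hu0, hu⟩ := exists_mulVec_eq_smul_of_mem_spectrum hz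
    by_cases hz0 : z = 0
    · simp [hz0]
    have hNeq : N.map (algebraMap ℝ ℂ) = M.map (algebraMap ℝ ℂ) - P.map (algebraMap ℝ ℂ) :=
      Matrix.map_sub _ (map_sub _) _ _
    -- An eigenvector of `N` for `z ≠ 0` is thus killed by `P`, hence is an eigenvector of `M`; for
    -- `z = 1` it would also be fixed by `P`.
    have hPN : P * N = 0 := by
      refine Matrix.ext_of_mulVec_single fun i => ?_
      rw [← mulVec_mulVec, sub_mulVec, mulVec_sub, hPM, hPP, sub_self, zero_mulVec]
    have hPu : P.map (algebraMap ℝ ℂ) *ᵥ u = 0 := by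
      have h1 : P.map (algebraMap ℝ ℂ) *ᵥ (N.map (algebraMap ℝ ℂ) *ᵥ u) = 0 := by
        rw [mulVec_mulVec, ← Matrix.map_mul, hPN, Matrix.map_zero _ (map_zero _), zero_mulVec]
      rw [hu, mulVec_smul] at h1
      exact (smul_eq_zero.1 h1).resolve_left hz0
    have hMu : M.map (algebraMap ℝ ℂ) *ᵥ u = z • u := by
      rw [← hu, hNeq, sub_mulVec, hPu, sub_zero]
    refine (hM z (mem_spectrum_of_mulVec_eq_smul hu0 hMu)).resolve_right ?_
    rintro rfl
    rw [one_smul, map_ofReal_mulVec_eq_iff] at hMu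
    have h2 : P.map (algebraMap ℝ ℂ) *ᵥ u = u :=
      (map_ofReal_mulVec_eq_iff _ _ _).2 ⟨hker _ hMu.1, hker _ hMu.2⟩
    exact hu0 (h2.symm.trans hPu)
  have hlim := tendsto_pow_mulVec_zero hNspec (fun i => (((v - P *ᵥ v) i : ℝ) : ℂ))
  have hmappow : ∀ k : ℕ, N.map (algebraMap ℝ ℂ) ^ k = (N ^ k).map (algebraMap ℝ ℂ) := fun k =>
    (Matrix.map_pow N (algebraMap ℝ ℂ) k).symm
  rw [← tendsto_sub_nhds_zero_iff, tendsto_pi_nhds]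
  intro i
  have h3 := (Complex.continuous_re.tendsto _).comp ((tendsto_pi_nhds.1 hlim) i)
  refine h3.congr fun k => ?_
  rw [hpow, Function.comp_apply, hmappow, map_ofReal_mulVec_re]
  simp only [Complex.ofReal_re]

end PowerConvergence

/-! ### Spectrum and semisimplicity of the expected update matrix. -/

section ExpectedUpdate

open Matrix

/-- Here `t` is a root of `p(t) = q t² - (h + 2a) t + a`. A nonreal root has `|t|² = a/q` and `2 Re
t = (h + 2a)/q`, so `|1 - t|² = 1 - (h + a)/q` with `a > 0`. A real root must lie in `(0, 2)`. -/
lemma norm_one_sub_lt_one_of_quadratic {t : ℂ} {q h a : ℝ} (ht : t ≠ 0) (hq : 0 < q)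
    (hh : 0 ≤ h) (ha : 0 ≤ a) (hlt : h + a < 4 / 3 * q)
    (heq : t ^ 2 * q = t * h + (2 * t - 1) * a) : ‖1 - t‖ < 1 := by
  obtain ⟨u, v⟩ := t
  have hre := congrArg Complex.re heq
  have him := congrArg Complex.im heq
  simp [pow_two] at hre him
  rw [← sq_lt_one_iff₀ (norm_nonneg _), Complex.sq_norm, Complex.normSq_apply]
  simp
  by_cases hv : v = 0
  · subst hv
    simp at hre ⊢
    have hu : u ≠ 0 := fun hu => ht (by simp [Complex.ext_iff, hu])
    have hu0 : 0 < u := by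
      rcases lt_or_gt_of_ne hu with hneg | hpos
      · nlinarith [mul_pos_of_neg_of_neg hneg hneg, mul_nonneg (neg_nonneg.2 hneg.le) hh,
          mul_nonneg (neg_nonneg.2 hneg.le) ha, mul_pos (mul_pos_of_neg_of_neg hneg hneg) hq]
      · exact hpos
    -- The constant `4/3` enters here: `p(2) = 4q - 2h - 3a ≥ 4q - 3(h + a) > 0`, and `p(u) ≥ p(2)`
    -- for `u ≥ 2`.
    have hu2 : u < 2 := by
      by_contra hcon
      push Not at hcon
      have : 0 ≤ (u - 2) * ((u + 2) * q - h - 2 * a) :=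
        mul_nonneg (by linarith) (by nlinarith)
      nlinarith
    nlinarith
  · have h1 : 2 * u * q = h + 2 * a := by
      apply mul_left_cancel₀ hv
      linarith
    have h2 : (u * u + v * v) * q = a := by linear_combination (-1) * hre + u * h1
    have h3 : 0 < (u * u + v * v) * q :=
      mul_pos (add_pos_of_nonneg_of_pos (mul_self_nonneg u) (mul_self_pos.2 hv)) hq
    nlinarith

variable {ι κ : Type*} [Fintype ι] [Fintype κ]

/-- The Hermitian form of a real symmetric matrix at a complex vector. -/
noncomputable def reForm (K : Matrix ι ι ℝ) (z : ι → ℂ) : ℝ :=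
  ((fun j => (z j).re) ⬝ᵥ K *ᵥ fun j => (z j).re) + ((fun j => (z j).im) ⬝ᵥ K *ᵥ fun j => (z j).im)

lemma star_dotProduct_map_mulVec {K : Matrix ι ι ℝ} (hK : Kᵀ = K) (z : ι → ℂ) :
    star z ⬝ᵥ K.map (algebraMap ℝ ℂ) *ᵥ z = reForm K z := by
  apply Complex.ext
  · simp only [dotProduct, Complex.re_sum, Complex.mul_re, map_ofReal_mulVec_re,
      map_ofReal_mulVec_im, reForm, Pi.star_apply, Complex.ofReal_re]
    simp [Finset.sum_add_distrib]
  · simp only [dotProduct, Complex.im_sum, Complex.mul_im, map_ofReal_mulVec_re,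
      map_ofReal_mulVec_im, Pi.star_apply, Complex.ofReal_im]
    have h1 : (fun j => (z j).re) ⬝ᵥ K *ᵥ (fun j => (z j).im) =
        (fun j => (z j).im) ⬝ᵥ K *ᵥ (fun j => (z j).re) := by
      rw [dotProduct_mulVec, ← mulVec_transpose, hK, dotProduct_comm]
    simp only [dotProduct] at h1
    simp [Finset.sum_add_distrib, h1]

variable [DecidableEq ι] [DecidableEq κ]

/-- The matrix `[I - QS, QAᵀ; -βA(I - QS), I - βAQAᵀ]` with `S = H + βAᵀA`. -/
noncomputable def admmMatrix (H : Matrix ι ι ℝ) (A : Matrix κ ι ℝ) (β : ℝ) (Q : Matrix ι ι ℝ) :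
    Matrix (ι ⊕ κ) (ι ⊕ κ) ℝ :=
  fromBlocks (1 - Q * (H + β • (Aᵀ * A))) (Q * Aᵀ)
    (-(β • (A * (1 - Q * (H + β • (Aᵀ * A)))))) (1 - β • (A * (Q * Aᵀ)))

variable {H : Matrix ι ι ℝ} {A : Matrix κ ι ℝ} {β : ℝ} {Q : Matrix ι ι ℝ}

lemma admmMatrix_mulVec (x : ι → ℝ) (μ : κ → ℝ) :
    admmMatrix H A β Q *ᵥ Sum.elim x μ =
      Sum.elim (x - Q *ᵥ ((H + β • (Aᵀ * A)) *ᵥ x - Aᵀ *ᵥ μ))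
        (μ - β • A *ᵥ (x - Q *ᵥ ((H + β • (Aᵀ * A)) *ᵥ x - Aᵀ *ᵥ μ))) := by
  rw [admmMatrix, fromBlocks_mulVec]
  congr 1
  · simp only [Sum.elim_comp_inl, Sum.elim_comp_inr, sub_mulVec, one_mulVec, ← mulVec_mulVec,
      mulVec_sub]
    abel
  · simp only [Sum.elim_comp_inl, Sum.elim_comp_inr, sub_mulVec, one_mulVec, ← mulVec_mulVec,
      mulVec_sub, neg_mulVec, smul_mulVec, smul_sub]
    abel

/-- Fixed vectors of `admmMatrix`, and its semisimplicity at `1`. -/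
lemma admmMatrix_sub_one_mulVec_eq_zero (hH : H.PosSemidef) (hβ : 0 < β)
    (hQp : ∀ v, v ≠ 0 → 0 < v ⬝ᵥ Q *ᵥ v) {x : ι → ℝ} {μ : κ → ℝ}
    (h : (admmMatrix H A β Q - 1) *ᵥ Sum.elim x μ = 0) :
    H *ᵥ x = 0 ∧ A *ᵥ x = 0 ∧ Aᵀ *ᵥ μ = 0 := by
  rw [sub_mulVec, one_mulVec, admmMatrix_mulVec, sub_eq_zero] at h
  set y := (H + β • (Aᵀ * A)) *ᵥ x - Aᵀ *ᵥ μ with hy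
  have h1 : x - Q *ᵥ y = x := funext fun i => congrFun h (Sum.inl i)
  have h2 : μ - β • A *ᵥ (x - Q *ᵥ y) = μ := funext fun i => congrFun h (Sum.inr i)
  have hy0 : y = 0 := by
    by_contra hne
    have h3 := hQp y hne
    rw [sub_eq_self.1 h1, dotProduct_zero] at h3
    exact h3.false
  have hAx : A *ᵥ x = 0 := by
    rw [h1] at h2
    exact (smul_eq_zero.1 (sub_eq_self.1 h2)).resolve_left hβ.ne'
  have hHx : H *ᵥ x = Aᵀ *ᵥ μ := by
    have := hy.symm.trans hy0
    rw [add_mulVec, smul_mulVec, ← mulVec_mulVec, hAx, mulVec_zero, smul_zero, add_zero,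
      sub_eq_zero] at this
    exact this
  -- Since `Hx = Aᵀμ` and `Ax = 0`; semidefiniteness of `H` then forces `Hx = 0`.
  have hxHx : x ⬝ᵥ H *ᵥ x = 0 := by
    rw [hHx, dotProduct_mulVec, vecMul_transpose, hAx, zero_dotProduct]
  have hHx0 : H *ᵥ x = 0 := by
    have := (hH.dotProduct_mulVec_zero_iff x).1 (by simpa using hxHx)
    simpa using this
  exact ⟨hHx0, hAx, by rw [← hHx, hHx0]⟩

/-- Let `(x, μ)` be the image of `(u, v)` under `M - 1`, with `Hx = 0`, `Ax = 0`, `Aᵀμ = 0`. From `μ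
= -βAu` follows `AᵀAu = 0`, so `μ = 0`. Moreover `x = -Qy` with `y = Hu - Aᵀv` orthogonal to `x`, so
`yᵀQy = 0` and `x = 0`. -/
lemma admmMatrix_semisimple (hH : H.PosSemidef) (hβ : 0 < β)
    (hQp : ∀ v, v ≠ 0 → 0 < v ⬝ᵥ Q *ᵥ v) (z : ι ⊕ κ → ℝ)
    (h : (admmMatrix H A β Q - 1) *ᵥ ((admmMatrix H A β Q - 1) *ᵥ z) = 0) :
    (admmMatrix H A β Q - 1) *ᵥ z = 0 := by
  have hHt : Hᵀ = H := by simpa using hH.1.eq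
  obtain ⟨u, v, rfl⟩ : ∃ u v, z = Sum.elim u v := ⟨_, _, (Sum.elim_comp_inl_inr z).symm⟩
  obtain ⟨x, μ, hxμ⟩ : ∃ x μ, (admmMatrix H A β Q - 1) *ᵥ Sum.elim u v = Sum.elim x μ :=
    ⟨_, _, (Sum.elim_comp_inl_inr _).symm⟩
  rw [hxμ] at h ⊢
  obtain ⟨hHx, hAx, hAμ⟩ := admmMatrix_sub_one_mulVec_eq_zero hH hβ hQp h
  rw [sub_mulVec, one_mulVec, admmMatrix_mulVec] at hxμ
  set y := (H + β • (Aᵀ * A)) *ᵥ u - Aᵀ *ᵥ v with hy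
  have h1 : x = -(Q *ᵥ y) := by
    have : (u - Q *ᵥ y) - u = x := funext fun i => congrFun hxμ (Sum.inl i)
    rw [← this]; abel
  have h2 : μ = -(β • A *ᵥ (u - Q *ᵥ y)) := by
    have : (v - β • A *ᵥ (u - Q *ᵥ y)) - v = μ := funext fun i => congrFun hxμ (Sum.inr i)
    rw [← this]; abel
  have hAQ : A *ᵥ (Q *ᵥ y) = 0 := by
    have := hAx
    rwa [h1, mulVec_neg, neg_eq_zero] at this
  rw [mulVec_sub, hAQ, sub_zero] at h2
  have hAAu : Aᵀ *ᵥ (A *ᵥ u) = 0 := by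
    rw [h2, mulVec_neg, mulVec_smul, neg_eq_zero] at hAμ
    exact (smul_eq_zero.1 hAμ).resolve_left hβ.ne'
  have hAu : A *ᵥ u = 0 := by
    have h3 : (A *ᵥ u) ⬝ᵥ (A *ᵥ u) = 0 := by
      rw [dotProduct_mulVec, ← mulVec_transpose, hAAu, zero_dotProduct]
    exact dotProduct_self_eq_zero.1 h3
  have hy2 : y = H *ᵥ u - Aᵀ *ᵥ v := by
    rw [hy, add_mulVec, smul_mulVec, ← mulVec_mulVec, hAAu, smul_zero, add_zero]
  have hxy : x ⬝ᵥ y = 0 := by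
    rw [hy2, dotProduct_sub, dotProduct_mulVec, dotProduct_mulVec, ← mulVec_transpose, hHt, hHx,
      vecMul_transpose, hAx, zero_dotProduct, zero_dotProduct, sub_zero]
  have hx0 : x = 0 := by
    by_cases hy0 : y = 0
    · rw [h1, hy0, mulVec_zero, neg_zero]
    · have h3 := hQp y hy0
      rw [h1, neg_dotProduct, neg_eq_zero, dotProduct_comm] at hxy
      exact absurd hxy h3.ne'
  rw [hx0, h2, hAu, smul_zero, neg_zero]
  exact Sum.elim_zero_zero

theorem norm_lt_one_or_eq_one_of_mem_spectrum_admmMatrix (hH : H.PosSemidef) (hβ : 0 < β)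
    (hQt : Qᵀ = Q) (hQp : ∀ v, v ≠ 0 → 0 < v ⬝ᵥ Q *ᵥ v)
    (hQS : ∀ v, v ≠ 0 →
      (Q *ᵥ v) ⬝ᵥ (H + β • (Aᵀ * A)) *ᵥ (Q *ᵥ v) < 4 / 3 * (v ⬝ᵥ Q *ᵥ v))
    {l : ℂ} (hl : l ∈ spectrum ℂ ((admmMatrix H A β Q).map (algebraMap ℝ ℂ))) :
    ‖l‖ < 1 ∨ l = 1 := by
  have hHt : Hᵀ = H := by simpa using hH.1.eq
  obtain ⟨z, hz0, hz⟩ := exists_mulVec_eq_smul_of_mem_spectrum hl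
  refine or_iff_not_imp_right.2 fun hl1 => ?_
  obtain ⟨t, ht⟩ : ∃ t, t = 1 - l := ⟨_, rfl⟩
  have ht0 : t ≠ 0 := by rw [ht]; exact sub_ne_zero.2 (Ne.symm hl1)
  have hlt : l = 1 - t := by rw [ht]; ring
  obtain ⟨x, μ, rfl⟩ : ∃ x μ, z = Sum.elim x μ := ⟨_, _, (Sum.elim_comp_inl_inr z).symm⟩
  set Qc := Q.map (algebraMap ℝ ℂ) with hQc
  set Hc := H.map (algebraMap ℝ ℂ) with hHc
  set Ac := A.map (algebraMap ℝ ℂ) with hAc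
  have hSc : (H + β • (Aᵀ * A)).map (algebraMap ℝ ℂ) = Hc + (β : ℂ) • (Acᵀ * Ac) := by
    ext i j
    simp [hHc, hAc, mul_apply]
  have hMc : (admmMatrix H A β Q).map (algebraMap ℝ ℂ) =
      fromBlocks (1 - Qc * (Hc + (β : ℂ) • (Acᵀ * Ac))) (Qc * Acᵀ)
        (-((β : ℂ) • (Ac * (1 - Qc * (Hc + (β : ℂ) • (Acᵀ * Ac))))))
        (1 - (β : ℂ) • (Ac * (Qc * Acᵀ))) := by
    have h1 : (1 - Q * (H + β • (Aᵀ * A))).map (algebraMap ℝ ℂ) =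
        1 - Qc * (Hc + (β : ℂ) • (Acᵀ * Ac)) := by
      rw [Matrix.map_sub _ (map_sub _), Matrix.map_one _ (map_zero _) (map_one _), Matrix.map_mul,
        hSc]
    have hQA : (Q * Aᵀ).map (algebraMap ℝ ℂ) = Qc * Acᵀ := by
      rw [Matrix.map_mul]; rfl
    rw [admmMatrix, fromBlocks_map, h1, hQA, Matrix.map_neg _ (map_neg _),
      Matrix.map_sub _ (map_sub _), Matrix.map_one _ (map_zero _) (map_one _)]
    congr 2
    · ext i j
      rw [← h1, ← Matrix.map_mul]
      simp
    · ext i j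
      rw [← hQA, ← Matrix.map_mul]
      simp
  rw [hMc, fromBlocks_mulVec] at hz
  obtain ⟨y, hy⟩ : ∃ y, y = (Hc + (β : ℂ) • (Acᵀ * Ac)) *ᵥ x - Acᵀ *ᵥ μ := ⟨_, rfl⟩
  have hz1 : x - Qc *ᵥ y = l • x := by
    rw [hy]
    have := funext fun i => congrFun hz (Sum.inl i)
    simp only [Sum.elim_inl, Sum.elim_comp_inl, Sum.elim_comp_inr, Pi.smul_apply] at this
    change _ = l • x at this
    rw [← this]
    ext i
    simp only [Pi.add_apply, sub_mulVec, one_mulVec, ← mulVec_mulVec, mulVec_sub, Pi.sub_apply]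
    ring
  have hz2 : μ - (β : ℂ) • Ac *ᵥ (l • x) = l • μ := by
    rw [← hz1, hy]
    have := funext fun i => congrFun hz (Sum.inr i)
    simp only [Sum.elim_inr, Sum.elim_comp_inl, Sum.elim_comp_inr, Pi.smul_apply] at this
    change _ = l • μ at this
    rw [← this]
    ext i
    simp only [Pi.add_apply, sub_mulVec, one_mulVec, ← mulVec_mulVec, mulVec_sub, Pi.sub_apply,
      neg_mulVec, smul_mulVec, smul_sub, Pi.neg_apply]
    ring
  have hx : t • x = Qc *ᵥ y := by
    rw [ht, sub_smul, one_smul, ← hz1]; abel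
  have hμ : t • μ = ((β : ℂ) * l) • Ac *ᵥ x := by
    rw [ht, sub_smul, one_smul, ← hz2, mulVec_smul, smul_smul]; abel
  -- The multiplier is eliminated through `tμ = β(1 - t)Ax`. Writing `y = t w`, `x = Qw` and pairing
  -- with `x` gives the scalar quadratic, with `q = w*Qw`, `h = x*Hx`, `a = β‖Ax‖²`.
  have hty : t • y = t • Hc *ᵥ x + ((2 * t - 1) * β) • Acᵀ *ᵥ (Ac *ᵥ x) := by
    rw [hy, smul_sub, ← mulVec_smul Acᵀ, hμ, add_mulVec, smul_mulVec, ← mulVec_mulVec, smul_add,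
      mulVec_smul, smul_smul, add_sub_assoc, ← sub_smul, hlt]
    congr 2
    ring
  obtain ⟨w, hw⟩ : ∃ w, w = t⁻¹ • y := ⟨_, rfl⟩
  have hyw : y = t • w := by rw [hw, smul_smul, mul_inv_cancel₀ ht0, one_smul]
  have hxw : x = Qc *ᵥ w := by rw [hw, mulVec_smul, ← hx, smul_smul, inv_mul_cancel₀ ht0, one_smul]
  have hw0 : w ≠ 0 := by
    rintro rfl
    rw [mulVec_zero] at hxw
    rw [hxw, mulVec_zero, smul_zero] at hμ
    have hμ0 := (smul_eq_zero.1 hμ).resolve_left ht0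
    exact hz0 (by rw [hxw, hμ0]; exact Sum.elim_zero_zero)
  have hxre : (fun j => (x j).re) = Q *ᵥ fun j => (w j).re := by
    rw [hxw]; funext i; exact map_ofReal_mulVec_re _ _ _
  have hxim : (fun j => (x j).im) = Q *ᵥ fun j => (w j).im := by
    rw [hxw]; funext i; exact map_ofReal_mulVec_im _ _ _
  have hAAt : (Aᵀ * A)ᵀ = Aᵀ * A := by simp
  have hreal : ∀ N : Matrix ι ι ℝ, (∀ v, 0 ≤ v ⬝ᵥ N *ᵥ v) → 0 ≤ reForm N x := fun N hN =>
    add_nonneg (hN _) (hN _)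
  have hQn : ∀ v, 0 ≤ v ⬝ᵥ Q *ᵥ v := fun v => by
    by_cases hv : v = 0
    · simp [hv]
    · exact (hQp v hv).le
  have hQSn : ∀ v, (Q *ᵥ v) ⬝ᵥ (H + β • (Aᵀ * A)) *ᵥ (Q *ᵥ v) ≤ 4 / 3 * (v ⬝ᵥ Q *ᵥ v) :=
    fun v => by
    by_cases hv : v = 0
    · simp [hv]
    · exact (hQS v hv).le
  have hne : (fun j => (w j).re) ≠ 0 ∨ (fun j => (w j).im) ≠ 0 := by
    by_contra! hcon
    exact hw0 (funext fun i => Complex.ext (congrFun hcon.1 i) (congrFun hcon.2 i))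
  have hq : 0 < reForm Q w := by
    rcases hne with h | h
    · exact add_pos_of_pos_of_nonneg (hQp _ h) (hQn _)
    · exact add_pos_of_nonneg_of_pos (hQn _) (hQp _ h)
  have hlt' : reForm (H + β • (Aᵀ * A)) x < 4 / 3 * reForm Q w := by
    rw [reForm, reForm, hxre, hxim, mul_add]
    rcases hne with h | h
    · exact add_lt_add_of_lt_of_le (hQS _ h) (hQSn _)
    · exact add_lt_add_of_le_of_lt (hQSn _) (hQS _ h)
  have hsplit : reForm (H + β • (Aᵀ * A)) x = reForm H x + β * reForm (Aᵀ * A) x := by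
    simp only [reForm, add_mulVec, smul_mulVec, dotProduct_add, dotProduct_smul, smul_eq_mul]
    ring
  rw [hsplit] at hlt'
  rw [hlt]
  refine norm_one_sub_lt_one_of_quadratic ht0 hq
    (hreal H fun v => by simpa using hH.dotProduct_mulVec_nonneg v)
    (mul_nonneg hβ.le (hreal (Aᵀ * A) fun v => ?_)) hlt' ?_
  · rw [← mulVec_mulVec, dotProduct_mulVec, vecMul_transpose]
    exact Finset.sum_nonneg fun i _ => mul_self_nonneg _
  have hxw' : star x ⬝ᵥ w = star w ⬝ᵥ Qc *ᵥ w := by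
    rw [star_dotProduct_map_mulVec hQt, hxw]
    have h1 : star w ⬝ᵥ Qc *ᵥ w = reForm Q w := star_dotProduct_map_mulVec hQt w
    have h2 := congrArg star h1
    rw [star_dotProduct] at h2
    simpa [dotProduct_comm] using h2
  have h1 := congrArg (fun v => star x ⬝ᵥ v) hty
  simp only [hyw, dotProduct_smul, dotProduct_add, smul_eq_mul, hxw'] at h1
  rw [star_dotProduct_map_mulVec hQt, star_dotProduct_map_mulVec hHt, mulVec_mulVec] at h1
  have h2 : Acᵀ * Ac = (Aᵀ * A).map (algebraMap ℝ ℂ) := by rw [Matrix.map_mul]; rfl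
  rw [h2, star_dotProduct_map_mulVec hAAt] at h1
  push_cast
  linear_combination h1

/-- Algebraic and geometric multiplicity of a semisimple eigenvalue agree. -/
lemma rootMultiplicity_charpoly_eq_finrank_eigenspace (M : Matrix ι ι ℝ)
    (hss : ∀ v, (M - 1) *ᵥ ((M - 1) *ᵥ v) = 0 → (M - 1) *ᵥ v = 0) :
    M.charpoly.rootMultiplicity 1 =
      Module.finrank ℝ (Module.End.eigenspace (Matrix.toLin' M) 1) := by
  have hf : ∀ v, (Matrix.toLin' M - (1 : ℝ) • (1 : Module.End ℝ (ι → ℝ))) v = (M - 1) *ᵥ v :=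
    fun v => by simp [sub_mulVec]
  -- The kernel of every power of `M - 1` lies in that of `M - 1`, so the generalized eigenspace,
  -- whose dimension is the algebraic multiplicity, is the eigenspace.
  have key : ∀ (k : ℕ) v,
      ((Matrix.toLin' M - (1 : ℝ) • (1 : Module.End ℝ (ι → ℝ))) ^ k) v = 0 → (M - 1) *ᵥ v = 0 := by
    intro k
    induction k with
    | zero => intro v hv; rw [show v = 0 by simpa using hv, mulVec_zero]
    | succ k ih =>
      intro v hv
      rw [pow_succ, Module.End.mul_apply, hf] at hv
      exact hss v (ih _ hv)
  have heq : Module.End.maxGenEigenspace (Matrix.toLin' M) 1 =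
      Module.End.eigenspace (Matrix.toLin' M) 1 := by
    ext v
    rw [Module.End.mem_maxGenEigenspace, Module.End.mem_eigenspace_iff]
    have h1 : (Matrix.toLin' M) v = (1 : ℝ) • v ↔ (M - 1) *ᵥ v = 0 := by
      simp [sub_mulVec, sub_eq_zero]
    rw [h1]
    exact ⟨fun ⟨k, hk⟩ => key k v hk, fun h => ⟨1, by rw [pow_one, hf, h]⟩⟩
  rw [← Matrix.charpoly_toLin', ← LinearMap.finrank_maxGenEigenspace_eq, heq]

end ExpectedUpdate

/-! ### Expectations of products of independent random matrices. -/

section RandomProducts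

open Matrix

/-- Expectation of a product of independent, identically distributed random matrices with finitely
many values, applied to a fixed vector. -/
theorem integral_random_matrix_iterate {α ι Ω : Type*} [Fintype α] [Fintype ι] [DecidableEq ι]
    [MeasurableSpace α] [MeasurableSingletonClass α] [MeasurableSpace Ω] {P : Measure Ω}
    [IsProbabilityMeasure P] {σ : ℕ → Ω → α} (hσ : ∀ k, Measurable (σ k)) (hind : iIndepFun σ P)
    {c : ℝ} (hunif : ∀ k τ, P.real {ω | σ k ω = τ} = c) (U : α → Matrix ι ι ℝ) (v : ι → ℝ)
    {e : ℕ → Ω → ι → ℝ} (he0 : ∀ ω, e 0 ω = v) (he : ∀ k ω, e (k + 1) ω = U (σ k ω) *ᵥ e k ω)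
    (k : ℕ) :
    (∀ i, Integrable (fun ω => e k ω i) P) ∧
      ∀ i, ∫ ω, e k ω i ∂P = ((c • ∑ τ, U τ) ^ k *ᵥ v) i := by
  -- `e k` depends only on the first `k` draws. It thus takes finitely many values, which gives
  -- integrability, and is independent of `σ k`.
  have hrep : ∀ k, ∃ ψ : (Finset.range k → α) → ι → ℝ, ∀ ω, e k ω = ψ fun i => σ i ω := by
    intro k
    induction k with
    | zero => exact ⟨fun _ => v, he0⟩
    | succ k ih =>
      obtain ⟨ψ, hψ⟩ := ih
      refine ⟨fun s => U (s ⟨k, by simp⟩) *ᵥ ψ fun i => s ⟨i, Finset.mem_range.2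
        ((Finset.mem_range.1 i.2).trans (Nat.lt_succ_self k))⟩, fun ω => ?_⟩
      rw [he, hψ]
  have hint : ∀ k i, Integrable (fun ω => e k ω i) P := by
    intro k i
    obtain ⟨ψ, hψ⟩ := hrep k
    have hm : Measurable fun ω => (fun j : Finset.range k => σ j ω) :=
      measurable_pi_lambda _ fun j => hσ _
    have h1 : Integrable (fun s => ψ s i) (P.map fun ω => (fun j : Finset.range k => σ j ω)) :=
      Integrable.of_finite
    have h2 := (integrable_map_measure h1.aestronglyMeasurable hm.aemeasurable).1 h1
    simpa [Function.comp_def, hψ] using h2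
  have hU : ∀ k i j, Integrable (fun ω => U (σ k ω) i j) P := fun k i j => by
    have h1 : Integrable (fun τ => U τ i j) (P.map (σ k)) := Integrable.of_finite
    exact (integrable_map_measure h1.aestronglyMeasurable (hσ k).aemeasurable).1 h1
  have hUint : ∀ k i j, ∫ ω, U (σ k ω) i j ∂P = (c • ∑ τ, U τ) i j := fun k i j => by
    have h1 : Integrable (fun τ => U τ i j) (P.map (σ k)) := Integrable.of_finite
    rw [← integral_map (hσ k).aemeasurable h1.aestronglyMeasurable, integral_fintype h1]
    have h2 : ∀ τ, (P.map (σ k)).real {τ} = c := fun τ => by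
      rw [map_measureReal_apply (hσ k) (measurableSet_singleton τ), ← hunif k τ]
      rfl
    simp only [h2, smul_eq_mul, ← Finset.mul_sum, Matrix.smul_apply, Matrix.sum_apply]
  refine ⟨hint k, ?_⟩
  induction k with
  | zero => intro i; simp [he0]
  | succ k ih =>
    intro i
    have hindep : ∀ j, IndepFun (fun ω => U (σ k ω) i j) (fun ω => e k ω j) P := fun j => by
      obtain ⟨ψ, hψ⟩ := hrep k
      have h1 := hind.indepFun_finset {k} (Finset.range k) (by simp) hσ
      have h2 := h1.comp (φ := fun s : (({k} : Finset ℕ) → α) => U (s ⟨k, by simp⟩) i j)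
        (ψ := fun s => ψ s j) (Measurable.of_discrete) (Measurable.of_discrete)
      simpa [Function.comp_def, hψ] using h2
    have hmul : ∀ j, Integrable (fun ω => U (σ k ω) i j * e k ω j) P := fun j =>
      (hindep j).integrable_mul (hU k i j) (hint k j)
    calc ∫ ω, e (k + 1) ω i ∂P = ∫ ω, ∑ j, U (σ k ω) i j * e k ω j ∂P := by
          simp only [he, mulVec, dotProduct]
      _ = ∑ j, ∫ ω, U (σ k ω) i j * e k ω j ∂P := integral_finsetSum _ fun j _ => hmul j
      _ = ∑ j, (c • ∑ τ, U τ) i j * ((c • ∑ τ, U τ) ^ k *ᵥ v) j := by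
          refine Finset.sum_congr rfl fun j _ => ?_
          rw [(hindep j).integral_fun_mul_eq_mul_integral (hU k i j).aestronglyMeasurable
            (hint k j).aestronglyMeasurable, hUint, ih]
      _ = ((c • ∑ τ, U τ) ^ (k + 1) *ᵥ v) i := by
          rw [pow_succ', ← mulVec_mulVec]; rfl

end RandomProducts

/-! ### From block minimization and KKT points to linear algebra. -/

section Iteration

open Matrix

variable {n m : ℕ} {d : Fin n → ℕ} {H : Matrix (BlockIdx d) (BlockIdx d) ℝ} {g : BlockVec d}
  {A : (i : Fin n) → Matrix (Fin m) (Fin (d i)) ℝ} {b : Fin m → ℝ} {β : ℝ}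

lemma eq_zero_of_forall_quadratic_nonneg {a q : ℝ} (hq : 0 ≤ q)
    (h : ∀ s : ℝ, 0 ≤ s * a + s ^ 2 * q) : a = 0 := by
  -- Using `q + 1` instead of `2q` covers `q = 0` as well.
  have h1 := h (-a / (q + 1))
  have h2 : 0 < q + 1 := by linarith
  have h3 : -a / (q + 1) * a + (-a / (q + 1)) ^ 2 * q = -(a ^ 2 / (q + 1) ^ 2) := by
    field_simp; ring
  rw [h3] at h1
  have h4 : a ^ 2 / (q + 1) ^ 2 ≤ 0 := by linarith
  rw [div_le_iff₀ (by positivity), zero_mul] at h4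
  nlinarith

lemma flat_add (x y : BlockVec d) : flat (x + y) = flat x + flat y := rfl

lemma flat_single_dotProduct (i : Fin n) (h : Fin (d i) → ℝ) (v : BlockIdx d → ℝ) :
    flat (Pi.single i h) ⬝ᵥ v = ∑ a, h a * v ⟨i, a⟩ := by
  simp only [dotProduct, flat, Fintype.sum_sigma]
  rw [Finset.sum_eq_single i]
  · simp
  · intro j _ hj; simp [Pi.single_eq_of_ne hj]
  · simp

/-- A convex quadratic is minimized over a block exactly where the block gradient vanishes. -/
lemma isMinOn_block_iff {S : Matrix (BlockIdx d) (BlockIdx d) ℝ} (hS : S.PosSemidef)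
    (c : BlockIdx d → ℝ) (k : ℝ) (z : BlockVec d) (i : Fin n) (y : Fin (d i) → ℝ) :
    IsMinOn (fun y => (1 / 2 : ℝ) * (flat (Function.update z i y) ⬝ᵥ
        S *ᵥ flat (Function.update z i y)) + c ⬝ᵥ flat (Function.update z i y) + k) Set.univ y ↔
      ∀ a, (S *ᵥ flat (Function.update z i y) + c) ⟨i, a⟩ = 0 := by
  have hSt : Sᵀ = S := by simpa using hS.1.eq
  have hexp : ∀ u e : BlockIdx d → ℝ, (1 / 2 : ℝ) * ((u + e) ⬝ᵥ S *ᵥ (u + e)) + c ⬝ᵥ (u + e) + k =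
      ((1 / 2 : ℝ) * (u ⬝ᵥ S *ᵥ u) + c ⬝ᵥ u + k) + (e ⬝ᵥ (S *ᵥ u + c) + 1 / 2 * (e ⬝ᵥ S *ᵥ e)) := by
    intro u e
    have h1 : u ⬝ᵥ S *ᵥ e = e ⬝ᵥ S *ᵥ u := by
      rw [dotProduct_mulVec, ← mulVec_transpose, hSt, dotProduct_comm]
    simp only [mulVec_add, add_dotProduct, dotProduct_add, h1, dotProduct_comm e c]
    ring
  have hnn : ∀ e : BlockIdx d → ℝ, 0 ≤ e ⬝ᵥ S *ᵥ e := fun e => by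
    simpa using hS.dotProduct_mulVec_nonneg e
  have hupd : ∀ h : Fin (d i) → ℝ, flat (Function.update z i (y + h)) =
      flat (Function.update z i y) + flat (Pi.single i h) := fun h => by
    rw [← flat_add]
    congr 1
    funext j
    by_cases hj : j = i
    · subst hj; simp
    · simp [Function.update_of_ne hj, Pi.single_eq_of_ne hj]
  constructor
  · intro hmin
    rw [isMinOn_univ_iff] at hmin
    set G := S *ᵥ flat (Function.update z i y) + c with hG
    have h1 : ∑ a, G ⟨i, a⟩ * G ⟨i, a⟩ = 0 := by
      -- The test direction is the block gradient itself.
      refine eq_zero_of_forall_quadratic_nonneg (q := 1 / 2 *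
        (flat (Pi.single i fun a => G ⟨i, a⟩) ⬝ᵥ S *ᵥ flat (Pi.single i fun a => G ⟨i, a⟩)))
        (mul_nonneg (by norm_num) (hnn _)) fun s => ?_
      have h2 := hmin (y + s • fun a => G ⟨i, a⟩)
      have h3 : flat (Pi.single i (s • fun a => G ⟨i, a⟩)) =
          s • flat (Pi.single i fun a => G ⟨i, a⟩) := by
        rw [Pi.single_smul]; rfl
      rw [hupd, hexp, h3, ← hG] at h2
      simp only [mulVec_smul, smul_dotProduct, dotProduct_smul, smul_eq_mul,
        flat_single_dotProduct i _ G] at h2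
      linarith
    intro a
    rw [Finset.sum_eq_zero_iff_of_nonneg fun a _ => mul_self_nonneg _] at h1
    exact mul_self_eq_zero.1 (h1 a (Finset.mem_univ a))
  · intro h0
    rw [isMinOn_univ_iff]
    intro y'
    have h1 : y' = y + (y' - y) := by abel
    rw [h1, hupd, hexp, flat_single_dotProduct]
    simp only [h0, mul_zero, Finset.sum_const_zero, zero_add]
    have := hnn (flat (Pi.single i (y' - y)))
    linarith

lemma sum_mulVec_eq_concatA_mulVec (x : BlockVec d) :
    ∑ i, A i *ᵥ x i = concatA A *ᵥ flat x := by
  ext r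
  simp [concatA, flat, mulVec, dotProduct, Fintype.sum_sigma, Finset.sum_apply]

lemma constrResidual_eq (x : BlockVec d) :
    constrResidual A b x = concatA A *ᵥ flat x - b := by
  rw [constrResidual, sum_mulVec_eq_concatA_mulVec]

lemma matS_posSemidef (hH : H.PosSemidef) (hβ : 0 < β) : (matS H A β).PosSemidef := by
  have h1 : ((concatA A)ᵀ * concatA A).PosSemidef := by
    simpa using posSemidef_conjTranspose_mul_self (concatA A)
  exact hH.add (h1.smul hβ.le)

/-- The linear coefficient of the augmented Lagrangian as a quadratic function of `x`. -/
noncomputable def augLinear (g : BlockVec d) (A : (i : Fin n) → Matrix (Fin m) (Fin (d i)) ℝ) (b : Fin m → ℝ)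
    (β : ℝ) (μ : Fin m → ℝ) : BlockIdx d → ℝ :=
  flat g - (concatA A)ᵀ *ᵥ μ - β • (concatA A)ᵀ *ᵥ b

lemma augLagrangian_eq (x : BlockVec d) (μ : Fin m → ℝ) :
    augLagrangian H g A b β x μ =
      (1 / 2 : ℝ) * (flat x ⬝ᵥ matS H A β *ᵥ flat x) + augLinear g A b β μ ⬝ᵥ flat x +
        (μ ⬝ᵥ b + β / 2 * (b ⬝ᵥ b)) := by
  have h1 : ∀ ν : Fin m → ℝ, ((concatA A)ᵀ *ᵥ ν) ⬝ᵥ flat x = ν ⬝ᵥ (concatA A *ᵥ flat x) :=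
    fun ν => by rw [mulVec_transpose, ← dotProduct_mulVec]
  have h2 : flat x ⬝ᵥ (concatA A)ᵀ *ᵥ (concatA A *ᵥ flat x) =
      (concatA A *ᵥ flat x) ⬝ᵥ (concatA A *ᵥ flat x) := by rw [dotProduct_comm, h1]
  rw [augLagrangian, objective, constrResidual_eq, matS, augLinear]
  simp only [add_mulVec, smul_mulVec, ← mulVec_mulVec, dotProduct_add, sub_dotProduct,
    dotProduct_sub, dotProduct_smul, smul_dotProduct, smul_eq_mul, h1, h2]
  rw [dotProduct_comm (concatA A *ᵥ flat x) b]
  ring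

lemma matL_eq_blockLower (σ : Equiv.Perm (Fin n)) :
    matL H A β σ = blockLower (matS H A β) σ := rfl

/-- The block optimality conditions are the block rows of one triangular system: in row `σ i`, new
values meet the entries of `L_σ` and old values those of `S - L_σ`. -/
lemma rpadmmStep_iff (hH : H.PosSemidef) (hβ : 0 < β) (σ : Equiv.Perm (Fin n)) (x x' : BlockVec d)
    (μ μ' : Fin m → ℝ) :
    RPADMMStep H g A b β σ x μ x' μ' ↔
      (matL H A β σ *ᵥ flat x' =
        (matL H A β σ - matS H A β) *ᵥ flat x - augLinear g A b β μ) ∧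
      μ' = μ - β • (concatA A *ᵥ flat x' - b) := by
  rw [RPADMMStep, constrResidual_eq]
  refine and_congr_left fun _ => ?_
  have hblock : ∀ i, IsMinOn (fun y : Fin (d (σ i)) → ℝ => augLagrangian H g A b β
      (Function.update (fun l => if σ.symm l < i then x' l else x l) (σ i) y) μ)
      Set.univ (x' (σ i)) ↔ ∀ a, (matL H A β σ *ᵥ flat x') ⟨σ i, a⟩ =
        ((matL H A β σ - matS H A β) *ᵥ flat x - augLinear g A b β μ) ⟨σ i, a⟩ := by
    intro i
    simp only [augLagrangian_eq]
    rw [isMinOn_block_iff (matS_posSemidef hH hβ)]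
    refine forall_congr' fun a => ?_
    have h1 : (matS H A β *ᵥ flat (Function.update (fun l => if σ.symm l < i then x' l else x l)
        (σ i) (x' (σ i)))) ⟨σ i, a⟩ = (matL H A β σ *ᵥ flat x' -
          (matL H A β σ - matS H A β) *ᵥ flat x) ⟨σ i, a⟩ := by
      simp only [mulVec, dotProduct, Pi.sub_apply, ← Finset.sum_sub_distrib]
      refine Finset.sum_congr rfl fun q _ => ?_
      have h2 : Function.update (fun l => if σ.symm l < i then x' l else x l) (σ i) (x' (σ i)) =
          fun l => if σ.symm l ≤ i then x' l else x l := by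
        funext l
        by_cases hl : l = σ i
        · subst hl; simp
        · have : σ.symm l ≠ i := fun h => hl (by rw [← h]; simp)
          simp [Function.update_of_ne hl, le_iff_lt_or_eq, this]
      rw [h2]
      simp only [matL, flat, of_apply, Equiv.symm_apply_apply, Matrix.sub_apply]
      split_ifs <;> ring
    rw [Pi.add_apply, h1, Pi.sub_apply, Pi.sub_apply]
    constructor <;> intro h <;> linarith
  rw [forall_congr' hblock]
  constructor
  · intro h
    funext ⟨j, a⟩
    obtain ⟨i, rfl⟩ := σ.surjective j
    exact h i a
  · intro h i a
    rw [h]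

lemma isKKT_iff (x : BlockVec d) (μ : Fin m → ℝ) :
    IsKKT H g A b x μ ↔
      H *ᵥ flat x + flat g = (concatA A)ᵀ *ᵥ μ ∧ concatA A *ᵥ flat x = b := by
  rw [IsKKT, sum_mulVec_eq_concatA_mulVec]
  refine and_congr_left fun _ => ?_
  have h1 : ∀ i a, ((A i)ᵀ *ᵥ μ) a = ((concatA A)ᵀ *ᵥ μ) ⟨i, a⟩ := fun i a => rfl
  constructor
  · intro h
    funext ⟨i, a⟩
    have := congrFun (h i) a
    rw [Pi.add_apply, h1, Pi.neg_apply, Pi.zero_apply] at this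
    linarith
  · intro h i
    funext a
    rw [Pi.add_apply, h1, Pi.neg_apply, Pi.zero_apply, h]
    ring

lemma flat_bijective : Function.Bijective (flat (d := d)) :=
  ⟨fun _ _ h => funext fun i => funext fun a => congrFun h ⟨i, a⟩,
    fun v => ⟨fun i a => v ⟨i, a⟩, rfl⟩⟩

/-- Both block diagonal summands are semidefinite, so the factor `β > 0` on the second does not
affect definiteness of the sum. -/
lemma blockDiagPart_matS_pos (hH : H.PosSemidef) (hβ : 0 < β)
    (hpos : (Matrix.blockDiagonal' (fun i => Matrix.blockDiag' H i) +
      Matrix.blockDiagonal' (fun i => (A i).transpose * A i)).PosDef)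
    (v : BlockIdx d → ℝ) (hv : v ≠ 0) : 0 < v ⬝ᵥ blockDiagPart (matS H A β) *ᵥ v := by
  have hbd : ∀ N : (i : Fin n) → Matrix (Fin (d i)) (Fin (d i)) ℝ,
      v ⬝ᵥ blockDiagonal' N *ᵥ v =
        ∑ i, (fun a => v ⟨i, a⟩) ⬝ᵥ N i *ᵥ (fun a => v ⟨i, a⟩) := by
    intro N
    simp only [dotProduct, mulVec, Fintype.sum_sigma]
    refine Finset.sum_congr rfl fun i _ => Finset.sum_congr rfl fun a _ => ?_
    congr 1
    rw [Finset.sum_eq_single i]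
    · simp [blockDiagonal'_apply_eq]
    · intro j _ hj
      simp [blockDiagonal'_apply_ne _ _ _ (Ne.symm hj)]
    · simp
  have hD : blockDiagPart (matS H A β) = blockDiagonal' (fun i => blockDiag' H i) +
      β • blockDiagonal' (fun i => (A i)ᵀ * A i) := by
    ext ⟨i, a⟩ ⟨j, c⟩
    by_cases hij : i = j
    · subst hij
      simp only [Matrix.add_apply, Matrix.smul_apply, blockDiagonal'_apply_eq]
      simp [blockDiagPart, matS, mul_apply, concatA, blockDiag'_apply]
    · simp only [Matrix.add_apply, Matrix.smul_apply, blockDiagonal'_apply_ne _ _ _ hij]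
      simp [blockDiagPart, hij]
  have h1 := hpos.dotProduct_mulVec_pos hv
  rw [star_trivial, add_mulVec, dotProduct_add] at h1
  rw [hD, add_mulVec, smul_mulVec, dotProduct_add, dotProduct_smul, smul_eq_mul]
  have h2 : 0 ≤ v ⬝ᵥ blockDiagonal' (fun i => blockDiag' H i) *ᵥ v := by
    rw [hbd]
    refine Finset.sum_nonneg fun i _ => ?_
    have := (hH.submatrix (fun a : Fin (d i) => (⟨i, a⟩ : BlockIdx d))).dotProduct_mulVec_nonneg
      (fun a => v ⟨i, a⟩)
    rwa [star_trivial] at this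
  have h3 : 0 ≤ v ⬝ᵥ blockDiagonal' (fun i => (A i)ᵀ * A i) *ᵥ v := by
    rw [hbd]
    refine Finset.sum_nonneg fun i _ => ?_
    rw [← mulVec_mulVec, dotProduct_mulVec, vecMul_transpose]
    exact Finset.sum_nonneg fun a _ => mul_self_nonneg _
  rcases h2.eq_or_lt with h | h
  · rw [← h, zero_add] at h1 ⊢
    exact mul_pos hβ h1
  · exact add_pos_of_pos_of_nonneg h (mul_nonneg hβ.le h3)

lemma updateMatrix_eq (σ : Equiv.Perm (Fin n)) (hL : IsUnit (matL H A β σ)) :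
    updateMatrix H A β σ = admmMatrix H (concatA A) β (matL H A β σ)⁻¹ := by
  have hL' : (matL H A β σ)⁻¹ * matL H A β σ = 1 :=
    nonsing_inv_mul _ ((isUnit_iff_isUnit_det _).1 hL)
  have hinv : (fromBlocks (matL H A β σ) 0 (β • concatA A) (1 : Matrix (Fin m) (Fin m) ℝ))⁻¹ =
      fromBlocks (matL H A β σ)⁻¹ 0 (-(β • (concatA A * (matL H A β σ)⁻¹))) 1 := by
    refine inv_eq_left_inv ?_
    rw [fromBlocks_multiply, ← fromBlocks_one]
    simp [hL', Matrix.mul_assoc]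
  rw [updateMatrix, hinv, fromBlocks_multiply, admmMatrix, ← matS]
  simp only [hL', add_zero, mul_one, Matrix.mul_zero, Matrix.mul_one,
    Matrix.mul_sub, Matrix.neg_mul,
    Matrix.smul_mul, Matrix.mul_assoc]
  congr 1
  · rw [smul_sub]
    abel
  · abel

/-- `admmMatrix` is affine in its last argument, so averaging passes to `L_σ⁻¹`. -/
lemma expectedUpdateMatrix_eq (hL : ∀ σ, IsUnit (matL H A β σ)) :
    expectedUpdateMatrix H A β = admmMatrix H (concatA A) β (avgInv (matS H A β)) := by
  have hf : (n.factorial : ℝ) ≠ 0 := by positivity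
  have hS : H + β • ((concatA A)ᵀ * concatA A) = matS H A β := rfl
  refine Matrix.ext_of_mulVec_single fun i => ?_
  obtain ⟨x, μ, hxμ⟩ : ∃ x μ, (Pi.single i 1 : BlockIdx d ⊕ Fin m → ℝ) = Sum.elim x μ :=
    ⟨_, _, (Sum.elim_comp_inl_inr _).symm⟩
  rw [hxμ, expectedUpdateMatrix, smul_mulVec, sum_mulVec]
  simp only [updateMatrix_eq _ (hL _), admmMatrix_mulVec, hS, avgInv, matL_eq_blockLower]
  ext (j | j)
  · simp only [Pi.smul_apply, Finset.sum_apply, Sum.elim_inl, Pi.sub_apply, smul_mulVec,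
      sum_mulVec, smul_eq_mul, Finset.sum_sub_distrib, Finset.sum_const, Finset.card_univ,
      Fintype.card_perm, Fintype.card_fin, nsmul_eq_mul, mul_sub]
    rw [inv_mul_cancel_left₀ hf]
  · simp only [Pi.smul_apply, Finset.sum_apply, Sum.elim_inr, Pi.sub_apply, smul_mulVec,
      sum_mulVec, smul_eq_mul, Finset.sum_sub_distrib, Finset.sum_const, Finset.card_univ,
      Fintype.card_perm, Fintype.card_fin, nsmul_eq_mul, mul_sub, mulVec_sub, mulVec_smul,
      mulVec_sum, ← Finset.mul_sum]
    simp only [mul_left_comm _ β, inv_mul_cancel_left₀ hf]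

/-- The error with respect to a KKT point is propagated linearly. -/
lemma RPADMMStep.error_eq (hH : H.PosSemidef) (hβ : 0 < β) {σ : Equiv.Perm (Fin n)}
    (hL : IsUnit (matL H A β σ)) {x x' xs : BlockVec d} {μ μ' μs : Fin m → ℝ}
    (h : RPADMMStep H g A b β σ x μ x' μ') (hs : IsKKT H g A b xs μs) :
    Sum.elim (flat x' - flat xs) (μ' - μs) =
      updateMatrix H A β σ *ᵥ Sum.elim (flat x - flat xs) (μ - μs) := by
  rw [rpadmmStep_iff hH hβ] at h
  rw [isKKT_iff] at hs
  obtain ⟨h1, h2⟩ := h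
  obtain ⟨h3, h4⟩ := hs
  have hx : flat x' - flat xs = (flat x - flat xs) - (matL H A β σ)⁻¹ *ᵥ
      (matS H A β *ᵥ (flat x - flat xs) - (concatA A)ᵀ *ᵥ (μ - μs)) := by
    apply mulVec_injective_iff_isUnit.2 hL
    rw [mulVec_sub (matL H A β σ) (flat x - flat xs), mulVec_mulVec,
      mul_nonsing_inv _ ((isUnit_iff_isUnit_det _).1 hL), one_mulVec, mulVec_sub, h1, augLinear]
    have h5 : matS H A β *ᵥ flat xs =
        H *ᵥ flat xs + β • (concatA A)ᵀ *ᵥ b := by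
      rw [matS, add_mulVec, smul_mulVec, ← mulVec_mulVec, h4]
    simp only [mulVec_sub, sub_mulVec, h5, ← h3]
    abel
  rw [updateMatrix_eq σ hL, admmMatrix_mulVec, ← matS, ← hx]
  congr 1
  rw [h2, mulVec_sub, h4]
  abel

end Iteration

/-! ### The main theorem. -/

theorem theorem3p1 {n m : ℕ} {d : Fin n → ℕ}
    (H : Matrix (BlockIdx d) (BlockIdx d) ℝ) (g : BlockVec d)
    (A : (i : Fin n) → Matrix (Fin m) (Fin (d i)) ℝ) (b : Fin m → ℝ) (β : ℝ)
    (hβ : 0 < β) (hH : H.PosSemidef)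
    (hKKT : ∃ (x : BlockVec d) (μ : Fin m → ℝ), IsKKT H g A b x μ)
    (hpos : (Matrix.blockDiagonal' (fun i => Matrix.blockDiag' H i) +
      Matrix.blockDiagonal' (fun i => (A i).transpose * A i)).PosDef) :
    -- every iteration is well defined: the subproblems have unique solutions
    (∀ (τ : Equiv.Perm (Fin n)) (x : BlockVec d) (μ : Fin m → ℝ),
      ∃! z : BlockVec d × (Fin m → ℝ), RPADMMStep H g A b β τ x μ z.1 z.2) ∧
    -- every complex eigenvalue of the expected update matrix is 1 or has modulus less than 1
    (∀ z ∈ spectrum ℂ ((expectedUpdateMatrix H A β).map (algebraMap ℝ ℂ)), ‖z‖ < 1 ∨ z = 1) ∧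
    -- the algebraic multiplicity of 1 equals its geometric multiplicity
    (expectedUpdateMatrix H A β).charpoly.rootMultiplicity 1 =
      Module.finrank ℝ (Module.End.eigenspace (Matrix.toLin' (expectedUpdateMatrix H A β)) 1) ∧
    -- the expected iterates converge to a KKT point
    (∀ {Ω : Type*} [MeasurableSpace Ω] (P : Measure Ω) [IsProbabilityMeasure P]
      (σ : ℕ → Ω → Equiv.Perm (Fin n)) (x₀ : BlockVec d) (μ₀ : Fin m → ℝ)
      (x : ℕ → Ω → BlockVec d) (μ : ℕ → Ω → Fin m → ℝ),
      IsRPADMM H g A b β P σ x₀ μ₀ x μ →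
      (∀ k, Integrable (x k) P ∧ Integrable (μ k) P) ∧
      ∃ (xbar : BlockVec d) (μbar : Fin m → ℝ), IsKKT H g A b xbar μbar ∧
        Tendsto (fun k => ∫ ω, x k ω ∂P) atTop (𝓝 xbar) ∧
        Tendsto (fun k => ∫ ω, μ k ω ∂P) atTop (𝓝 μbar)) := by
  have hS := matS_posSemidef (A := A) hH hβ
  have hD := blockDiagPart_matS_pos hH hβ hpos
  have hL : ∀ σ, IsUnit (matL H A β σ) := fun σ => isUnit_blockLower hS hD σ
  have hM := expectedUpdateMatrix_eq hL
  have hQp : ∀ v, v ≠ 0 → 0 < v ⬝ᵥ (avgInv (matS H A β)).mulVec v := fun v hv =>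
    avgInv_pos hS hD hv
  have hspec : ∀ z ∈ spectrum ℂ ((expectedUpdateMatrix H A β).map (algebraMap ℝ ℂ)),
      ‖z‖ < 1 ∨ z = 1 := by
    rw [hM]
    exact fun z hz => norm_lt_one_or_eq_one_of_mem_spectrum_admmMatrix hH hβ
      (avgInv_transpose hS) hQp (fun v hv => dotProduct_avgInv_lt hS hD hv) hz
  have hss : ∀ v, (expectedUpdateMatrix H A β - 1).mulVec
      ((expectedUpdateMatrix H A β - 1).mulVec v) = 0 →
      (expectedUpdateMatrix H A β - 1).mulVec v = 0 := by
    rw [hM]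
    exact admmMatrix_semisimple hH hβ hQp
  refine ⟨fun τ x μ => ?_, hspec, rootMultiplicity_charpoly_eq_finrank_eigenspace _ hss, ?_⟩
  · obtain ⟨x', hx'⟩ := flat_bijective.2 ((matL H A β τ)⁻¹.mulVec
      ((matL H A β τ - matS H A β).mulVec (flat x) - augLinear g A b β μ))
    have hsol : (matL H A β τ).mulVec (flat x') =
        (matL H A β τ - matS H A β).mulVec (flat x) - augLinear g A b β μ := by
      rw [hx']; exact blockLower_mulVec_inv hS hD τ _
    refine ⟨(x', μ - β • ((concatA A).mulVec (flat x') - b)), ?_, ?_⟩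
    · exact (rpadmmStep_iff hH hβ τ x x' μ _).2 ⟨hsol, rfl⟩
    · rintro ⟨y, ν⟩ hy
      obtain ⟨h1, h2⟩ := (rpadmmStep_iff hH hβ τ x y μ ν).1 hy
      have h3 : y = x' := flat_bijective.1
        (Matrix.mulVec_injective_iff_isUnit.2 (hL τ) (h1.trans hsol.symm))
      rw [h2, h3]
  · intro Ω _ P _ σ x₀ μ₀ x μ hit
    obtain ⟨xs, μs, hs⟩ := hKKT
    let e : ℕ → Ω → (BlockIdx d ⊕ Fin m) → ℝ := fun k ω =>
      Sum.elim (flat (x k ω) - flat xs) (μ k ω - μs)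
    let _ : MeasurableSpace (Equiv.Perm (Fin n)) := ⊤
    have hunif : ∀ k τ, P.real {ω | σ k ω = τ} = ((n.factorial : ℕ) : ℝ)⁻¹ := fun k τ => by
      rw [Measure.real, hit.uniform k τ]; simp
    have hE := integral_random_matrix_iterate hit.measurable hit.indep hunif
      (updateMatrix H A β) (Sum.elim (flat x₀ - flat xs) (μ₀ - μs)) (e := e)
      (fun ω => by simp only [e, hit.init_x, hit.init_μ])
      (fun k ω => (hit.step k ω).error_eq hH hβ (hL _) hs)
    have hxint : ∀ k i a, Integrable (fun ω => x k ω i a) P := fun k i a => by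
      refine (((hE k).1 (Sum.inl ⟨i, a⟩)).add (integrable_const (xs i a))).congr
        (.of_forall fun ω => ?_)
      simp [e, flat]
    have hμint : ∀ k r, Integrable (fun ω => μ k ω r) P := fun k r => by
      refine (((hE k).1 (Sum.inr r)).add (integrable_const (μs r))).congr (.of_forall fun ω => ?_)
      simp [e]
    have hxint' : ∀ k i, Integrable (fun ω => x k ω i) P := fun k i => Integrable.of_eval (hxint k i)
    refine ⟨fun k => ⟨Integrable.of_eval (hxint' k), Integrable.of_eval (hμint k)⟩, ?_⟩
    obtain ⟨w, hw, hlim⟩ := exists_tendsto_pow_mulVec _ hspec hss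
      (Sum.elim (flat x₀ - flat xs) (μ₀ - μs))
    obtain ⟨u, ν, rfl⟩ : ∃ u ν, w = Sum.elim u ν := ⟨_, _, (Sum.elim_comp_inl_inr w).symm⟩
    obtain ⟨u, rfl⟩ := flat_bijective.2 u
    have hfix : (expectedUpdateMatrix H A β - 1).mulVec (Sum.elim (flat u) ν) = 0 := by
      rw [Matrix.sub_mulVec, Matrix.one_mulVec, hw, sub_self]
    rw [hM] at hfix
    obtain ⟨hHu, hAu, hAν⟩ := admmMatrix_sub_one_mulVec_eq_zero hH hβ hQp hfix
    -- The limit `(u, ν)` of the expected errors solves the homogeneous KKT system, so adding it to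
    -- the reference KKT point yields another one. This limit point may depend on the start.
    refine ⟨xs + u, μs + ν, ?_, ?_, ?_⟩
    · rw [isKKT_iff] at hs ⊢
      rw [flat_add, Matrix.mulVec_add, Matrix.mulVec_add, Matrix.mulVec_add, hHu, hAu, hAν]
      simpa using hs
    · refine tendsto_pi_nhds.2 fun i => tendsto_pi_nhds.2 fun a => ?_
      have h1 := ((tendsto_pi_nhds.1 hlim) (Sum.inl ⟨i, a⟩)).const_add (xs i a)
      refine h1.congr fun k => ?_
      rw [eval_integral (hxint' k), eval_integral (hxint k i)]
      have h2 := (hE k).2 (Sum.inl ⟨i, a⟩)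
      rw [← expectedUpdateMatrix] at h2
      rw [← h2]
      simp only [e, Sum.elim_inl, Pi.sub_apply, flat]
      rw [integral_sub (hxint k i a) (integrable_const _)]
      simp
    · refine tendsto_pi_nhds.2 fun r => ?_
      have h1 := ((tendsto_pi_nhds.1 hlim) (Sum.inr r)).const_add (μs r)
      refine h1.congr fun k => ?_
      rw [eval_integral (hμint k)]
      have h2 := (hE k).2 (Sum.inr r)
      rw [← expectedUpdateMatrix] at h2
      rw [← h2]
      simp only [e, Sum.elim_inr, Pi.sub_apply]
      rw [integral_sub (hμint k r) (integrable_const _)]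
      simp
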